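/- **Setting.** There are $N\ge 1$ players with decision sets $X_i\subseteq\mathbb R^{d_i}$, maps $\psi_i:\mathbb R^{d_i}\to\mathbb R^n$, the aggregate $\sigma(x)=\frac1N\sum_{i}\psi_i(x_i)$, and constraint functions $g_i:\mathbb R^{d_i}\to\mathbb R^m$; put $g(x)=\sum_i g_i(x_i)$. Player $i$ has a random vector $\xi_i$ in $\mathbb R^{r_i}$ and sampled costs $F_{i,t}(x_i,y,\xi_i)$, $t\ge 0$, such that $f_i(x_i,y)=\mathbb E[F_{i,t}(x_i,y,\xi_i)]$ is finite and does not depend on $t$ (time-invariant game $\Gamma$). Let $$p_i(x_i,y)=\nabla_1 f_i(x_i,y)+\tfrac1N\nabla\psi_i(x_i)\nabla_2 f_i(x_i,y),\qquad q_{i,t}(x_i,y,\xi)=\nabla_1 F_{i,t}(x_i,y,\xi)+\tfrac1N\nabla\psi_i(x_i)\nabla_2 F_{i,t}(x_i,y,\xi),$$ where $\nabla$ of a vector-valued map is its transposed Jacobian. The samples $\xi_{i,t}$ live on one probability space and have the law of $\xi_i$; $\mathscr F_t$ is the $\sigma$-algebra generated by the $\xi_{j,s}$ with $j\in\{1,\dots,N\}$,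 $s<t$. **Assumptions.** 1. (Network) The weights $w_{ij,t}\ge 0$ satisfy $w_{ii,t}>0$ and $\sum_i w_{ij,t}=1$; there is $\underline w\in(0,1)$ with $w_{ij,t}\ge\underline w$ whenever $w_{ij,t}>0$; and there is an integer $U>0$ such that for every $t$ the union over $l=0,\dots,U-1$ of the directed graphs with edges $\{(j,i):w_{ij,t+l}>0\}$ is strongly connected. 2. (Game) The $X_i$ are nonempty, convex and compact; some $x\in\prod_i X_i$ satisfies $g(x)<0$ componentwise; $F_{i,t}(\cdot,\cdot,\xi)$ and $f_i$ are differentiable at the points of $X_i\times\mathbb R^n$; $x_i\mapsto f_i(x_i,\sigma(x))$ is convex on $X_i$ for fixed $x_{-i}$; the components of $g_i$ are differentiable and convex on $X_i$, and $\nabla g_i$ is bounded on $X_i$; $\psi_i$ is differentiable and Lipschitz continuous on $X_i$. 3. There is $L_f>0$ with $\|p_i(x_i,y)-p_i(x_i,y')\|\le L_f\|y-y'\|$ for all $i$, $x_i\in X_i$, $y,y'\in\mathbb R^n$. 4. (Samples) There are $\iota,S>0$ such that for all $i,t$ and all $\mathscr F_t$-measurable $x_i\in X_i$, $y\in\mathbb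 R^n$, almost surely: $\mathbb E[q_{i,t}(x_i,y,\xi_{i,t})\mid\mathscr F_t]=p_i(x_i,y)$; $\mathbb E[\exp(\|q_{i,t}(x_i,y,\xi_{i,t})-p_i(x_i,y)\|^2/\iota^2)\mid\mathscr F_t]\le e$; and $\|q_{i,t}(x_i,y,\xi_{i,t})\|\le S$. 5. For some $\mu>0$, the pseudo-gradient $G(x)=(p_i(x_i,\sigma(x)))_{i}$ satisfies $\langle G(x)-G(x'),x-x'\rangle\ge\mu\|x-x'\|^2$ for all $x,x'\in\prod_iX_i$. **Algorithm.** Start from $z_{i,0}=1$, $x_{i,0}\in X_i$, $\mu_{i,0}=0$, $\sigma_{i,0}=\psi_i(x_{i,0})$. For $t\ge 0$ put $z_{i,t+1}=\sum_j w_{ij,t}z_{j,t}$, $\hat\mu_{i,t}=\sum_jw_{ij,t}\mu_{j,t}$, $\hat\sigma_{i,t}=\sum_jw_{ij,t}\sigma_{j,t}$ and $$s_{i,t+1}=q_{i,t}\Big(x_{i,t},\frac{\hat\sigma_{i,t}}{z_{i,t+1}},\xi_{i,t}\Big)+\nabla g_i(x_{i,t})\frac{\hat\mu_{i,t}}{z_{i,t+1}},\qquad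 x_{i,t+1}=\Pi_{X_i}[x_{i,t}-\alpha_ts_{i,t+1}],$$ $$\mu_{i,t+1}=[\hat\mu_{i,t}+\gamma_t(g_i(x_{i,t})-\beta_t\hat\mu_{i,t})]_+,\qquad \sigma_{i,t+1}=\hat\sigma_{i,t}+\psi_i(x_{i,t+1})-\psi_i(x_{i,t}),$$ where $\Pi_{X_i}$ is the Euclidean projection onto $X_i$, $[\cdot]_+$ is the componentwise positive part, $\alpha_0=\beta_0=\gamma_0=1$, and $\alpha_t=t^{-a_1}$, $\beta_t=t^{-a_2}$, $\gamma_t=t^{-a_3}$ for $t\ge 1$, with $0<a_1,a_3<1$, $a_1>2a_2>0$ and $2a_2+a_3<1$. **Theorem.** Let $x^*$ be the variational generalized Nash equilibrium (vGNE) of $\Gamma$: $x^*\in\prod_iX_i$, $g(x^*)\le 0$, each $x_i^*$ minimizes the cost of player $i$ over its feasible decisions given $x_{-i}^*$, and there is one multiplier $\lambda^*\in\mathbb R^m_+$, common to all players, with $0\in p_i(x_i^*,\sigma(x^*))+\nabla g_i(x_i^*)\lambda^*+\mathbf N_{X_i}(x_i^*)$ for all $i$ and $0\in-g(x^*)+\mathbf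 N_{\mathbb R^m_+}(\lambda^*)$, where $\mathbf N$ denotes the normal cone. Then there is a constant $C>0$, independent of $T$ and $\delta$, such that for all $T\ge 1$ and all $0<\delta<1$, with probability at least $1-\delta$, the average $\bar x_T=\frac1T\sum_{t=1}^Tx_t$ satisfies $$\|\bar x_T-x^*\|^2\le C\Big(T^{-\min\{1-a_1,\,1-2a_2-a_3,\,a_3,\,a_2,\,a_1-2a_2\}}+T^{-(1-a_1)}\ln\tfrac1\delta\Big).$$ -/

import Mathlib

open MeasureTheory ProbabilityTheory

noncomputable section

/-- The Euclidean space of dimension `k`. -/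
abbrev Euc (k : ℕ) : Type := EuclideanSpace ℝ (Fin k)

/-- The nonnegative orthant. -/
def orthant (k : ℕ) : Set (Euc k) := {v | ∀ j, 0 ≤ v j}

/-- The componentwise positive part, i.e. the projection onto the nonnegative orthant. -/
def posPartVec {k : ℕ} (v : Euc k) : Euc k := WithLp.toLp 2 (fun j => max (v j) 0)

/-- The normal cone of `K` at `x`. -/
def normalCone {k : ℕ} (K : Set (Euc k)) (x : Euc k) : Set (Euc k) :=
  {s | ∀ y ∈ K, inner ℝ s (y - x) ≤ 0}

open Classical in
/-- The projection of `x` onto `K`: a point of `K` at minimal distance from `x` (it exists and is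
unique when `K` is nonempty, closed and convex; the value is `x` if there is no such point). -/
def proj {k : ℕ} (K : Set (Euc k)) (x : Euc k) : Euc k :=
  if h : ∃ y ∈ K, ∀ w ∈ K, ‖y - x‖ ≤ ‖w - x‖ then h.choose else x

/-- The matrix `∇h(x)` whose columns are the gradients of the components of `h`
(the transposed Jacobian), as a linear map. -/
def gradMap {k l : ℕ} (h : Euc k → Euc l) (x : Euc k) : Euc l →L[ℝ] Euc k :=
  ContinuousLinearMap.adjoint (fderiv ℝ h x)

/-- The data of a stochastic aggregative game with `N` players whose constraint functions do not
depend on time: decision sets `X i`, sampled costs `F i t x y ξ` (`x` the own decision, `y` the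
aggregate, `ξ` the random vector), contributions `ψ i` to the aggregate, private constraint
functions `g i`, and the law `law i` of the random vector of player `i`. -/
structure AggGame (N n m : ℕ) (d r : Fin N → ℕ) where
  X : ∀ i, Set (Euc (d i))
  F : ∀ i, ℕ → Euc (d i) → Euc n → Euc (r i) → ℝ
  ψ : ∀ i, Euc (d i) → Euc n
  g : ∀ i, Euc (d i) → Euc m
  law : ∀ i, Measure (Euc (r i))

namespace AggGame

variable {N n m : ℕ} {d r : Fin N → ℕ}

/-- The aggregate `σ(x) = (1/N) ∑ ψ_i(x_i)`. -/
def agg (Γ : AggGame N n m d r) (x : ∀ i, Euc (d i)) : Euc n :=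
  (1 / (N : ℝ)) • ∑ i, Γ.ψ i (x i)

/-- The coupled constraint function `g(x) = ∑ g_i(x_i)`. -/
def gsum (Γ : AggGame N n m d r) (x : ∀ i, Euc (d i)) : Euc m :=
  ∑ i, Γ.g i (x i)

/-- The expected cost `E[F_{i,t}(x, y, ξ_i)]` of player `i` at time `t`. -/
def cost (Γ : AggGame N n m d r) (i : Fin N) (t : ℕ) (x : Euc (d i)) (y : Euc n) : ℝ :=
  ∫ ξ, Γ.F i t x y ξ ∂(Γ.law i)

/-- The cost `f_i` of the time-invariant game, for which all `cost i t` coincide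
(see `TimeInvariant`). -/
def f (Γ : AggGame N n m d r) (i : Fin N) (x : Euc (d i)) (y : Euc n) : ℝ :=
  Γ.cost i 0 x y

/-- The expected costs are well defined and do not depend on time. (The constraint functions are
independent of time by construction; the sampled costs may depend on time.) -/
structure TimeInvariant (Γ : AggGame N n m d r) : Prop where
  prob : ∀ i, IsProbabilityMeasure (Γ.law i)
  integrable : ∀ i t x y, Integrable (Γ.F i t x y) (Γ.law i)
  cost_eq : ∀ i t x y, Γ.cost i t x y = Γ.f i x y

/-- `p_i(x, y) = ∇₁ f_i(x, y) + (1/N) ∇ψ_i(x) ∇₂ f_i(x, y)`. -/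
def p (Γ : AggGame N n m d r) (i : Fin N) (x : Euc (d i)) (y : Euc n) : Euc (d i) :=
  gradient (fun u => Γ.f i u y) x
    + (1 / (N : ℝ)) • gradMap (Γ.ψ i) x (gradient (fun v => Γ.f i x v) y)

/-- The sampled gradient
`q_{i,t}(x, y, ξ) = ∇₁ F_{i,t}(x, y, ξ) + (1/N) ∇ψ_i(x) ∇₂ F_{i,t}(x, y, ξ)`. -/
def q (Γ : AggGame N n m d r) (i : Fin N) (t : ℕ) (x : Euc (d i)) (y : Euc n) (ξ : Euc (r i)) :
    Euc (d i) :=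
  gradient (fun u => Γ.F i t u y ξ) x
    + (1 / (N : ℝ)) • gradMap (Γ.ψ i) x (gradient (fun v => Γ.F i t x v ξ) y)

/-- The pseudo-gradient `G(x) = col(∇_{x_i} f_i(x_i, σ(x)))`, in the Euclidean product space. -/
def pseudoGradient (Γ : AggGame N n m d r) (x : ∀ i, Euc (d i)) :
    PiLp 2 (fun i => Euc (d i)) :=
  WithLp.toLp 2 (fun i => Γ.p i (x i) (Γ.agg x))

/-- The pseudo-gradient is strongly monotone with modulus `κ` on `X_1 × ⋯ × X_N`. -/
def StronglyMonotone (Γ : AggGame N n m d r) (κ : ℝ) : Prop :=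
  ∀ x x' : ∀ i, Euc (d i), (∀ i, x i ∈ Γ.X i) → (∀ i, x' i ∈ Γ.X i) →
    κ * ‖WithLp.toLp 2 x - WithLp.toLp 2 x'‖ ^ 2
      ≤ inner ℝ (Γ.pseudoGradient x - Γ.pseudoGradient x')
          (WithLp.toLp 2 x - WithLp.toLp 2 x')

/-- Generalized Nash equilibrium: `x` is feasible, and every `x_i` minimizes the cost of player `i`
over the decisions that are feasible given the decisions of the others. -/
def IsGNE (Γ : AggGame N n m d r) (x : ∀ i, Euc (d i)) : Prop :=
  (∀ i, x i ∈ Γ.X i) ∧ (∀ j, Γ.gsum x j ≤ 0) ∧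
    ∀ i, ∀ u ∈ Γ.X i, (∀ j, Γ.gsum (Function.update x i u) j ≤ 0) →
      Γ.f i (x i) (Γ.agg x) ≤ Γ.f i u (Γ.agg (Function.update x i u))

/-- Variational generalized Nash equilibrium: a generalized Nash equilibrium that satisfies the
Karush-Kuhn-Tucker conditions with one multiplier `μ` common to all players. -/
def IsVGNE (Γ : AggGame N n m d r) (x : ∀ i, Euc (d i)) : Prop :=
  Γ.IsGNE x ∧ ∃ μ ∈ orthant m,
    (∀ i, ∃ v ∈ normalCone (Γ.X i) (x i),
      Γ.p i (x i) (Γ.agg x) + gradMap (Γ.g i) (x i) μ + v = 0) ∧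
    ∃ v ∈ normalCone (orthant m) μ, -Γ.gsum x + v = 0

/-- The assumptions on decision sets, costs, constraints and contributions to the aggregate. -/
structure SetAssumption (Γ : AggGame N n m d r) : Prop where
  nonempty : ∀ i, (Γ.X i).Nonempty
  convex : ∀ i, Convex ℝ (Γ.X i)
  compact : ∀ i, IsCompact (Γ.X i)
  slater : ∃ x : ∀ i, Euc (d i), (∀ i, x i ∈ Γ.X i) ∧ ∀ j, Γ.gsum x j < 0
  F_diff : ∀ i t ξ, ∀ x ∈ Γ.X i, ∀ y,
    DifferentiableAt ℝ (fun z : Euc (d i) × Euc n => Γ.F i t z.1 z.2 ξ) (x, y)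
  f_diff : ∀ i, ∀ x ∈ Γ.X i, ∀ y,
    DifferentiableAt ℝ (fun z : Euc (d i) × Euc n => Γ.f i z.1 z.2) (x, y)
  f_convex : ∀ i, ∀ x : ∀ i, Euc (d i),
    ConvexOn ℝ (Γ.X i) (fun u => Γ.f i u (Γ.agg (Function.update x i u)))
  g_diff : ∀ i, ∀ x ∈ Γ.X i, DifferentiableAt ℝ (Γ.g i) x
  g_convex : ∀ i j, ConvexOn ℝ (Γ.X i) (fun x => Γ.g i x j)
  g_grad_bdd : ∃ M : ℝ, ∀ i, ∀ x ∈ Γ.X i, ‖gradMap (Γ.g i) x‖ ≤ M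
  g_grad_meas : ∀ i, Measurable (fun x : Γ.X i => gradMap (Γ.g i) x)
  ψ_diff : ∀ i, ∀ x ∈ Γ.X i, DifferentiableAt ℝ (Γ.ψ i) x
  ψ_lip : ∃ Lσ > 0, ∀ i, ∀ x ∈ Γ.X i, ∀ x' ∈ Γ.X i, ‖Γ.ψ i x - Γ.ψ i x'‖ ≤ Lσ * ‖x - x'‖

/-- `p_i` is Lipschitz continuous in the aggregate, uniformly in the own decision. -/
def GradLipschitz (Γ : AggGame N n m d r) : Prop :=
  ∃ Lf > 0, ∀ i, ∀ x ∈ Γ.X i, ∀ y y', ‖Γ.p i x y - Γ.p i x y'‖ ≤ Lf * ‖y - y'‖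

/-- The state of the algorithm: for each player the push-sum weight `z`, the decision `x`, the
local multiplier `mu` and the local tracker `sigma`. -/
structure AlgState (N n m : ℕ) (d : Fin N → ℕ) where
  z : Fin N → ℝ
  x : ∀ i, Euc (d i)
  mu : Fin N → Euc m
  sigma : Fin N → Euc n

/-- The initial state, for initial decisions `x0`. -/
def initState (Γ : AggGame N n m d r) (x0 : ∀ i, Euc (d i)) : AlgState N n m d where
  z := fun _ => 1
  x := x0
  mu := fun _ => 0
  sigma := fun i => Γ.ψ i (x0 i)

/-- One round of the distributed stochastic primal-dual push-sum algorithm at time `t`, with weight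
matrix `w`, parameters `α β γ` and samples `ξ`. -/
def step (Γ : AggGame N n m d r) (w : Matrix (Fin N) (Fin N) ℝ) (α β γ : ℝ) (t : ℕ)
    (ξ : ∀ i, Euc (r i)) (s : AlgState N n m d) : AlgState N n m d :=
  let z' : Fin N → ℝ := fun i => ∑ j, w i j * s.z j
  let muHat : Fin N → Euc m := fun i => ∑ j, w i j • s.mu j
  let sigmaHat : Fin N → Euc n := fun i => ∑ j, w i j • s.sigma j
  let dir : ∀ i, Euc (d i) := fun i =>
    Γ.q i t (s.x i) ((z' i)⁻¹ • sigmaHat i) (ξ i)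
      + gradMap (Γ.g i) (s.x i) ((z' i)⁻¹ • muHat i)
  let x' : ∀ i, Euc (d i) := fun i => proj (Γ.X i) (s.x i - α • dir i)
  { z := z'
    x := x'
    mu := fun i => posPartVec (muHat i + γ • (Γ.g i (s.x i) - β • muHat i))
    sigma := fun i => sigmaHat i + Γ.ψ i (x' i) - Γ.ψ i (s.x i) }

/-- The states of the algorithm along a sample path `ξ`. -/
def run (Γ : AggGame N n m d r) (W : ℕ → Matrix (Fin N) (Fin N) ℝ) (α β γ : ℕ → ℝ)
    (x0 : ∀ i, Euc (d i)) (ξ : ℕ → ∀ i, Euc (r i)) : ℕ → AlgState N n m d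
  | 0 => Γ.initState x0
  | t + 1 => Γ.step (W t) (α t) (β t) (γ t) t (ξ t) (run Γ W α β γ x0 ξ t)

/-- The time average `(1/T) ∑_{t=1}^T x_t` of the decisions, in the Euclidean product space. -/
def avgDecision (Γ : AggGame N n m d r) (W : ℕ → Matrix (Fin N) (Fin N) ℝ) (α β γ : ℕ → ℝ)
    (x0 : ∀ i, Euc (d i)) (ξ : ℕ → ∀ i, Euc (r i)) (T : ℕ) : PiLp 2 (fun i => Euc (d i)) :=
  (1 / (T : ℝ)) • ∑ t ∈ Finset.Icc 1 T, WithLp.toLp 2 ((Γ.run W α β γ x0 ξ t).x)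

/-- The sigma-algebra generated by the samples `ξ_{i,s}` with `s < t`. -/
abbrev history {Ω : Type*} (ξ : ∀ i : Fin N, ℕ → Ω → Euc (r i)) (t : ℕ) : MeasurableSpace Ω :=
  ⨆ i, ⨆ s, ⨆ _ : s < t, MeasurableSpace.comap (ξ i s) inferInstance

/-- The assumptions on the samples: `ξ i t` is drawn from the law of the random vector of player
`i`; the sampled gradients are conditionally unbiased, conditionally sub-Gaussian and bounded, at
all points that are measurable with respect to the past. (The sampled gradient at such points is
measurable by `q_meas` and bounded, so that the conditional expectations are genuine.) -/
structure SampleAssumption (Γ : AggGame N n m d r) {Ω : Type*} [MeasurableSpace Ω] (P : Measure Ω)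
    (ξ : ∀ i : Fin N, ℕ → Ω → Euc (r i)) : Prop where
  meas : ∀ i t, Measurable (ξ i t)
  law_eq : ∀ i t, P.map (ξ i t) = Γ.law i
  q_meas : ∀ i t, Measurable
    (fun z : Γ.X i × Euc n × Euc (r i) => Γ.q i t z.1 z.2.1 z.2.2)
  unbiased : ∀ i t (x : Ω → Euc (d i)) (y : Ω → Euc n),
    Measurable[history ξ t] x → (∀ ω, x ω ∈ Γ.X i) → Measurable[history ξ t] y →
      P[fun ω => Γ.q i t (x ω) (y ω) (ξ i t ω) | history ξ t] =ᵐ[P] fun ω => Γ.p i (x ω) (y ω)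
  subGaussian : ∃ ι > 0, ∀ i t (x : Ω → Euc (d i)) (y : Ω → Euc n),
    Measurable[history ξ t] x → (∀ ω, x ω ∈ Γ.X i) → Measurable[history ξ t] y →
      P[fun ω => Real.exp (‖Γ.q i t (x ω) (y ω) (ξ i t ω) - Γ.p i (x ω) (y ω)‖ ^ 2 / ι ^ 2)
        | history ξ t] ≤ᵐ[P] fun _ => Real.exp 1
  bounded : ∃ S > 0, ∀ i t (x : Ω → Euc (d i)) (y : Ω → Euc n),
    Measurable[history ξ t] x → (∀ ω, x ω ∈ Γ.X i) → Measurable[history ξ t] y →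
      ∀ᵐ ω ∂P, ‖Γ.q i t (x ω) (y ω) (ξ i t ω)‖ ≤ S

end AggGame

/-- The assumptions on the time-varying communication networks. `W t i j` is the weight that player
`i` gives at time `t` to the information of player `j`; `(j, i)` is an edge iff it is positive. -/
structure GraphAssumption {N : ℕ} (W : ℕ → Matrix (Fin N) (Fin N) ℝ) : Prop where
  nonneg : ∀ t i j, 0 ≤ W t i j
  self_pos : ∀ t i, 0 < W t i i
  lower : ∃ w : ℝ, 0 < w ∧ w < 1 ∧ ∀ t i j, 0 < W t i j → w ≤ W t i j
  col_stochastic : ∀ t j, ∑ i, W t i j = 1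
  connected : ∃ U : ℕ, 0 < U ∧ ∀ t a b,
    Relation.ReflTransGen (fun j i => ∃ l < U, 0 < W (t + l) i j) a b

/-- The polynomial stepsize: `1` at time `0` and `1 / t ^ a` at times `t ≥ 1`. -/
def polyStep (a : ℝ) (t : ℕ) : ℝ := if t = 0 then 1 else 1 / (t : ℝ) ^ a

/-- The exponent `min {1 - a1, 1 - 2 a2 - a3, a3, a2, a1 - 2 a2}`. -/
def rateExp (a1 a2 a3 : ℝ) : ℝ :=
  min (1 - a1) (min (1 - 2 * a2 - a3) (min a3 (min a2 (a1 - 2 * a2))))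

end

/-! Apart from the sampling noise, everything is a deterministic estimate along one sample path. Let
ν_i be player i's push-sum estimate of the mean multiplier. A projected step, the KKT conditions at
x*, convexity of the g_i and strong monotonicity bound κ‖x_t - x*‖² by a difference of squared
distances to x* with weight 1/(2α_t), a term of order α_t/β_t², the noise, consensus errors, and the
coupling -∑⟨ν_i - λ*, g_i(x_i)⟩ (`primal_step`). The dual step bounds the same coupling by a
difference of squared distances from the mean multiplier to λ* with weight N/(2γ_t), plus terms of
order β_t and γ_t and consensus errors (`dual_step`).

The regularization by β_t costs the term β_t, but it keeps the multipliers of order 1/β_t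
(`sum_norm_mu_le`); this bounds the search directions without any a priori bound on the dual
variables. Consensus errors are summed by an ℓ¹ contraction: products of the weights over a fixed
number of rounds have uniformly positive entries, so they shrink zero-sum vectors, and the
accumulated error is at most a multiple of the accumulated perturbation
(`exists_sum_pushSum_error_le`). Summation by parts handles the weighted differences and yields
`exists_regret_bound`.

The noise paired with x* - x_t is a sum of bounded martingale differences. The Chernoff bound with
the fixed parameter T^(-a1) gives T^a1 ln(1/δ) plus a term of order T^(1-a1), which is why ln(1/δ)
enters linearly (`exists_noise_bound`). Dividing by T and using convexity of the squared norm passes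
to the average. -/

/-! ### Euclidean projection onto a compact convex set -/

theorem proj_spec {k : ℕ} {K : Set (Euc k)} (hne : K.Nonempty) (hc : IsCompact K) (x : Euc k) :
    proj K x ∈ K ∧ ∀ w ∈ K, ‖proj K x - x‖ ≤ ‖w - x‖ := by
  have h : ∃ y ∈ K, ∀ w ∈ K, ‖y - x‖ ≤ ‖w - x‖ := by
    obtain ⟨y, hy, hmin⟩ := hc.exists_isMinOn hne
      (f := fun y => ‖y - x‖) (by fun_prop)
    exact ⟨y, hy, fun w hw => hmin hw⟩
  unfold proj
  rw [dif_pos h]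
  exact h.choose_spec

theorem inner_sub_proj_le {k : ℕ} {K : Set (Euc k)} (hne : K.Nonempty) (hc : IsCompact K)
    (hconv : Convex ℝ K) (x : Euc k) {w : Euc k} (hw : w ∈ K) :
    inner ℝ (x - proj K x) (w - proj K x) ≤ 0 := by
  obtain ⟨hmem, hmin⟩ := proj_spec hne hc x
  have : Nonempty K := hne.to_subtype
  refine (norm_eq_iInf_iff_real_inner_le_zero hconv hmem).1 ?_ w hw
  apply le_antisymm
  · refine le_ciInf fun v => ?_
    rw [norm_sub_rev, norm_sub_rev x]
    exact hmin v v.2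
  · exact ciInf_le ⟨0, by rintro _ ⟨v, rfl⟩; exact norm_nonneg _⟩ (⟨_, hmem⟩ : K)

/-- Adding the variational inequalities of the two projections gives firm nonexpansiveness;
Cauchy-Schwarz then finishes. -/
theorem norm_proj_sub_proj_le {k : ℕ} {K : Set (Euc k)} (hne : K.Nonempty) (hc : IsCompact K)
    (hconv : Convex ℝ K) (x y : Euc k) : ‖proj K x - proj K y‖ ≤ ‖x - y‖ := by
  have h1 := inner_sub_proj_le hne hc hconv x (proj_spec hne hc y).1
  have h2 := inner_sub_proj_le hne hc hconv y (proj_spec hne hc x).1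
  set a := proj K x
  set b := proj K y
  have h3 : inner ℝ (a - b) (a - b) ≤ inner ℝ (x - y) (a - b) := by
    have e : inner ℝ (x - y) (a - b) - inner ℝ (a - b) (a - b)
        = -inner ℝ (x - a) (b - a) - inner ℝ (y - b) (a - b) := by
      rw [← neg_sub a b, inner_neg_right]
      simp only [inner_sub_left]
      ring
    linarith
  rw [real_inner_self_eq_norm_sq] at h3
  have h4 := real_inner_le_norm (x - y) (a - b)
  by_contra! h
  nlinarith [norm_nonneg (a - b), norm_nonneg (x - y)]

theorem continuous_proj {k : ℕ} {K : Set (Euc k)} (hne : K.Nonempty) (hc : IsCompact K)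
    (hconv : Convex ℝ K) : Continuous (proj K) := by
  refine (LipschitzWith.of_dist_le_mul (K := 1) fun x y => ?_).continuous
  simpa [dist_eq_norm] using norm_proj_sub_proj_le hne hc hconv x y

theorem proj_of_mem {k : ℕ} {K : Set (Euc k)} (hc : IsCompact K)
    {x : Euc k} (hx : x ∈ K) : proj K x = x := by
  have := (proj_spec ⟨x, hx⟩ hc x).2 x hx
  rw [sub_self, norm_zero] at this
  exact sub_eq_zero.1 (norm_le_zero_iff.1 this)

theorem norm_proj_sub_le {k : ℕ} {K : Set (Euc k)} (hc : IsCompact K)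
    (hconv : Convex ℝ K) (x : Euc k) {y : Euc k} (hy : y ∈ K) : ‖proj K x - y‖ ≤ ‖x - y‖ := by
  have := norm_proj_sub_proj_le ⟨y, hy⟩ hc hconv x y
  rwa [proj_of_mem hc hy] at this

/-! ### Positive part, dual increments and the gradient inequality -/

@[simp] theorem posPartVec_apply {k : ℕ} (v : Euc k) (j : Fin k) :
    posPartVec v j = max (v j) 0 := rfl

theorem posPartVec_nonneg {k : ℕ} (v : Euc k) (j : Fin k) : 0 ≤ posPartVec v j := le_max_right _ _

theorem posPartVec_of_nonneg {k : ℕ} {v : Euc k} (hv : ∀ j, 0 ≤ v j) : posPartVec v = v := by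
  ext j; simp [hv j]

theorem norm_posPartVec_sub_le {k : ℕ} (v w : Euc k) :
    ‖posPartVec v - posPartVec w‖ ≤ ‖v - w‖ := by
  rw [EuclideanSpace.norm_eq, EuclideanSpace.norm_eq]
  refine Real.sqrt_le_sqrt (Finset.sum_le_sum fun j _ => ?_)
  have : ‖(posPartVec v - posPartVec w) j‖ ≤ ‖(v - w) j‖ := by
    simpa using abs_max_sub_max_le_abs (v j) (w j) 0
  gcongr

theorem norm_posPartVec_le {k : ℕ} (v : Euc k) : ‖posPartVec v‖ ≤ ‖v‖ := by
  have := norm_posPartVec_sub_le v 0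
  rwa [posPartVec_of_nonneg (v := 0) (by simp), sub_zero, sub_zero] at this

theorem continuous_posPartVec {k : ℕ} : Continuous (posPartVec (k := k)) := by
  refine (LipschitzWith.of_dist_le_mul (K := 1) fun x y => ?_).continuous
  simpa [dist_eq_norm] using norm_posPartVec_sub_le x y

theorem inner_nonneg_of_nonneg {k : ℕ} {v w : Euc k} (hv : ∀ j, 0 ≤ v j) (hw : ∀ j, 0 ≤ w j) :
    0 ≤ inner ℝ v w := by
  rw [PiLp.inner_apply]
  exact Finset.sum_nonneg fun j _ => by simpa using mul_nonneg (hw j) (hv j)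

theorem inner_le_inner_of_nonneg {k : ℕ} {u v w : Euc k} (hu : ∀ j, 0 ≤ u j)
    (h : ∀ j, v j ≤ w j) : inner ℝ u v ≤ inner ℝ u w := by
  have := inner_nonneg_of_nonneg (w := w - v) hu (by simpa using h)
  rw [inner_sub_right] at this
  linarith

/-- One dual coordinate step: the truncated increment is no better than the free one, up to a
second order term. -/
theorem mul_posPart_increment_le {a h z l : ℝ} (ha : 0 ≤ a) (hz : 0 < z) (hl : 0 ≤ l) :
    (a / z - l) * (max (a + h) 0 - a) ≤ (a / z - l) * h + h ^ 2 / z := by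
  rcases le_total 0 (a + h) with h0 | h0
  · rw [max_eq_left h0]
    have : 0 ≤ h ^ 2 / z := by positivity
    linarith
  · rw [max_eq_right h0]
    -- Truncation is active here, so a + h ≤ 0 ≤ a and both summands on the right are nonnegative.
    -- The term h²/z pays for the factor a/z, which has the unfavourable sign.
    have e : (a / z - l) * h + h ^ 2 / z - (a / z - l) * (0 - a)
        = ((a + h) ^ 2 + a * -h) / z + l * -(a + h) := by
      field_simp; ring
    have e2 : 0 ≤ ((a + h) ^ 2 + a * -h) / z :=
      div_nonneg (add_nonneg (sq_nonneg _) (mul_nonneg ha (by linarith))) hz.le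
    have e3 : 0 ≤ l * -(a + h) := mul_nonneg hl (by linarith)
    linarith

theorem inner_posPartVec_increment_le {k : ℕ} {a h l : Euc k} {z : ℝ} (ha : ∀ j, 0 ≤ a j)
    (hz : 0 < z) (hl : ∀ j, 0 ≤ l j) :
    inner ℝ (z⁻¹ • a - l) (posPartVec (a + h) - a) ≤ inner ℝ (z⁻¹ • a - l) h + ‖h‖ ^ 2 / z := by
  rw [PiLp.inner_apply, PiLp.inner_apply, EuclideanSpace.real_norm_sq_eq, Finset.sum_div,
    ← Finset.sum_add_distrib]
  refine Finset.sum_le_sum fun j _ => ?_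
  have := mul_posPart_increment_le (h := h j) (ha j) hz (hl j)
  simp only [PiLp.sub_apply, PiLp.smul_apply, posPartVec_apply, PiLp.add_apply, smul_eq_mul,
    RCLike.inner_apply, conj_trivial]
  rw [div_eq_inv_mul] at this
  linarith

/-- The gradient inequality for a function convex on a set and differentiable at a point of it. -/
theorem fderiv_apply_le_of_convexOn {k l : ℕ} {K : Set (Euc k)} {h : Euc k → Euc l} {j : Fin l}
    (hc : ConvexOn ℝ K (fun x => h x j)) {x y : Euc k} (hx : x ∈ K) (hy : y ∈ K)
    (hd : DifferentiableAt ℝ h x) : fderiv ℝ h x (y - x) j ≤ h y j - h x j := by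
  -- On the segment from x to y the claim is one-dimensional: the derivative at 0 is at most the
  -- slope between 0 and 1.
  have hcomp := hc.comp_affineMap (AffineMap.lineMap (k := ℝ) x y)
  have hder : HasDerivAt ((fun x => h x j) ∘ (AffineMap.lineMap (k := ℝ) x y))
      (fderiv ℝ h x (y - x) j) 0 := by
    have h1 : HasFDerivAt h (fderiv ℝ h x) (AffineMap.lineMap (k := ℝ) x y (0 : ℝ)) := by
      simpa using hd.hasFDerivAt
    have h2 := h1.comp_hasDerivAt (0 : ℝ) (AffineMap.hasDerivAt_lineMap (a := x) (b := y))
    exact (EuclideanSpace.proj (𝕜 := ℝ) j).hasFDerivAt.comp_hasDerivAt (0 : ℝ) h2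
  have := hcomp.le_slope_of_hasDerivAt (x := 0) (y := 1) (by simpa using hx) (by simpa using hy)
    one_pos hder
  simpa [slope_def_field] using this

/-! ### Summation by parts and polynomial stepsizes -/

/-- Summation by parts: the increments of c are nonnegative and multiply values of a, which A
dominates. A may grow, as needed for multipliers of order 1/β_t. -/
theorem sum_mul_sub_le {c a A : ℕ → ℝ} (hc : Monotone c) (hc0 : 0 ≤ c 0) (ha : ∀ t, 0 ≤ a t)
    (hA : Monotone A) (haA : ∀ t, a t ≤ A t) (T : ℕ) :
    ∑ t ∈ Finset.range (T + 1), c t * (a t - a (t + 1)) ≤ A T * c T := by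
  have hcn : ∀ t, 0 ≤ c t := fun t => hc0.trans (hc (Nat.zero_le t))
  -- The boundary term -c_T a_{T+1} is kept so that the induction closes; it is dropped afterwards.
  have key : ∑ t ∈ Finset.range (T + 1), c t * (a t - a (t + 1)) ≤ A T * c T - c T * a (T + 1) := by
    induction T with
    | zero => simp; nlinarith [haA 0]
    | succ T ih =>
      rw [Finset.sum_range_succ]
      have h1 := hc (Nat.le_succ T)
      have h2 := hA (Nat.le_succ T)
      have h4 := mul_le_mul_of_nonneg_left (haA (T + 1)) (sub_nonneg.2 h1)
      have h5 := mul_le_mul_of_nonneg_right h2 (hcn T)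
      simp only [Nat.succ_eq_add_one] at *
      nlinarith
  nlinarith [mul_nonneg (hcn T) (ha (T + 1))]

/-- Concavity of s ↦ s^(1-a), in the form of Bernoulli's inequality at -1/(t+1). -/
theorem mul_rpow_le_sub {a : ℝ} (ha0 : 0 ≤ a) (ha1 : a < 1) {t : ℝ} (ht : 1 ≤ t) :
    (1 - a) * (t + 1) ^ (-a) ≤ (t + 1) ^ (1 - a) - t ^ (1 - a) := by
  have hb := rpow_one_add_le_one_add_mul_self (s := -1 / (t + 1)) (p := 1 - a)
    (by rw [le_div_iff₀ (by linarith)]; linarith) (by linarith) (by linarith)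
  have h1 : 1 + -1 / (t + 1) = t / (t + 1) := by field_simp; ring
  rw [h1, Real.div_rpow (by linarith) (by linarith), div_le_iff₀ (by positivity)] at hb
  have h2 : (t + 1) ^ (1 - a) = (t + 1) * (t + 1) ^ (-a) := by
    rw [sub_eq_add_neg, Real.rpow_add (by linarith), Real.rpow_one]
  rw [h2] at hb ⊢
  have : (1 + (1 - a) * (-1 / (t + 1))) * ((t + 1) * (t + 1) ^ (-a))
      = (t + 1) * (t + 1) ^ (-a) - (1 - a) * (t + 1) ^ (-a) := by
    field_simp; ring
  linarith

/-- Telescoping of `mul_rpow_le_sub`. The factor 2 covers the times 0 and 1, each of which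
contributes 1. -/
theorem sum_polyStep_le {a : ℝ} (ha0 : 0 ≤ a) (ha1 : a < 1) {T : ℕ} (hT : 1 ≤ T) :
    ∑ t ∈ Finset.range (T + 1), polyStep a t ≤ (2 / (1 - a)) * (T : ℝ) ^ (1 - a) := by
  have h1a : 0 < 1 - a := by linarith
  rw [div_mul_eq_mul_div, le_div_iff₀ h1a]
  induction T, hT using Nat.le_induction with
  | base => simp [Finset.sum_range_succ, polyStep]; linarith
  | succ T hT ih =>
    rw [Finset.sum_range_succ, add_mul]
    have hT' : (1 : ℝ) ≤ T := by exact_mod_cast hT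
    have h := mul_rpow_le_sub ha0 ha1 hT'
    have h2 : polyStep a (T + 1) = ((T : ℝ) + 1) ^ (-a) := by
      simp [polyStep, Real.rpow_neg (show (0 : ℝ) ≤ T + 1 by linarith)]
    have h3 := Real.rpow_nonneg (show (0 : ℝ) ≤ T + 1 by linarith) (-a)
    rw [h2]; push_cast
    nlinarith

theorem polyStep_pos (a : ℝ) (t : ℕ) : 0 < polyStep a t := by
  unfold polyStep
  split_ifs with h
  · exact one_pos
  · have : (0 : ℝ) < t := by exact_mod_cast Nat.pos_of_ne_zero h
    positivity

theorem polyStep_zero (a : ℝ) : polyStep a 0 = 1 := by simp [polyStep]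

theorem polyStep_of_pos (a : ℝ) {t : ℕ} (ht : 1 ≤ t) : polyStep a t = (t : ℝ) ^ (-a) := by
  rw [polyStep, if_neg (by omega), Real.rpow_neg (Nat.cast_nonneg t), one_div]

theorem antitone_polyStep {a : ℝ} (ha : 0 ≤ a) : Antitone (polyStep a) := by
  refine antitone_nat_of_succ_le fun t => ?_
  rcases Nat.eq_zero_or_pos t with rfl | ht
  · simp [polyStep]
  · rw [polyStep_of_pos a ht, polyStep_of_pos a (by omega)]
    exact Real.rpow_le_rpow_of_nonpos (by exact_mod_cast ht) (by push_cast; linarith) (by linarith)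

theorem polyStep_le_one {a : ℝ} (ha : 0 ≤ a) (t : ℕ) : polyStep a t ≤ 1 :=
  polyStep_zero a ▸ antitone_polyStep ha (Nat.zero_le t)

theorem polyStep_div (a b : ℝ) (t : ℕ) : polyStep a t / polyStep b t = polyStep (a - b) t := by
  rcases Nat.eq_zero_or_pos t with rfl | ht
  · simp [polyStep]
  · have : (0 : ℝ) < t := by exact_mod_cast ht
    rw [polyStep_of_pos a ht, polyStep_of_pos b ht, polyStep_of_pos _ ht, ← Real.rpow_sub this]
    congr 1; ring

/-! ### Concentration for bounded martingale differences -/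

/-- Exponential moments of sums of bounded martingale differences. -/
theorem integral_exp_sum_martingaleDiff_le {Ω : Type*} {m0 : MeasurableSpace Ω} {P : Measure Ω}
    [IsProbabilityMeasure P] {ℱ : ℕ → MeasurableSpace Ω} (hmono : Monotone ℱ) (hle : ∀ t, ℱ t ≤ m0)
    {D : ℕ → Ω → ℝ} (hmeas : ∀ t, StronglyMeasurable[ℱ (t + 1)] (D t)) {c : ℝ} (hc : 0 < c)
    (hbdd : ∀ t, ∀ᵐ ω ∂P, |D t ω| ≤ c) (hzero : ∀ t, P[D t | ℱ t] =ᵐ[P] 0) (l : ℝ) (n : ℕ) :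
    Integrable (fun ω => Real.exp (l * ∑ t ∈ Finset.range n, D t ω)) P ∧
    ∫ ω, Real.exp (l * ∑ t ∈ Finset.range n, D t ω) ∂P ≤ Real.exp (n * (l ^ 2 * c ^ 2 / 2)) := by
  have hSm : ∀ n, StronglyMeasurable[ℱ n] (fun ω => ∑ t ∈ Finset.range n, D t ω) := by
    intro n
    refine Finset.stronglyMeasurable_fun_sum _ fun t ht => ?_
    exact (hmeas t).mono (hmono (Finset.mem_range.1 ht))
  have hEm : ∀ n, StronglyMeasurable[ℱ n]
      (fun ω => Real.exp (l * ∑ t ∈ Finset.range n, D t ω)) := fun n =>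
    Real.continuous_exp.comp_stronglyMeasurable ((hSm n).const_mul l)
  have hall : ∀ᵐ ω ∂P, ∀ t, |D t ω| ≤ c := ae_all_iff.2 hbdd
  have hint : ∀ n, Integrable (fun ω => Real.exp (l * ∑ t ∈ Finset.range n, D t ω)) P := by
    intro n
    refine Integrable.of_bound ((hEm n).mono (hle n)).aestronglyMeasurable
      (Real.exp (|l| * (n * c))) ?_
    filter_upwards [hall] with ω hω
    rw [Real.norm_eq_abs, Real.abs_exp, Real.exp_le_exp]
    refine (le_abs_self _).trans ?_
    rw [abs_mul]
    gcongr
    refine (Finset.abs_sum_le_sum_abs _ _).trans ((Finset.sum_le_sum fun t _ => hω t).trans ?_)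
    simp
  refine ⟨hint n, ?_⟩
  induction n with
  | zero => simp
  | succ n ih =>
    set E := fun ω => Real.exp (l * ∑ t ∈ Finset.range n, D t ω) with hE
    have hDint : Integrable (D n) P :=
      Integrable.of_bound ((hmeas n).mono (hle _)).aestronglyMeasurable c (hbdd n)
    have hEDint : Integrable (E * D n) P := by
      have := (hint n).mul_bdd (c := c) hDint.aestronglyMeasurable (hbdd n)
      exact this
    -- E is known at time n and factors out of the conditional expectation of D n, which vanishes.
    have hz : ∫ ω, (E * D n) ω ∂P = 0 := by
      rw [← integral_condExp (hle n)]
      have h1 := condExp_mul_of_stronglyMeasurable_left (hEm n) hEDint hDint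
      rw [integral_congr_ae h1]
      refine integral_eq_zero_of_ae ?_
      filter_upwards [hzero n] with ω hω
      simp [hω]
    -- On [-c, c] the convex function x ↦ exp(l x) lies below its chord cosh(lc) + (sinh(lc)/c) x;
    -- the linear part integrates to zero.
    have hpt : ∀ᵐ ω ∂P, Real.exp (l * ∑ t ∈ Finset.range (n + 1), D t ω)
        ≤ Real.cosh (l * c) * E ω + Real.sinh (l * c) / c * (E * D n) ω := by
      filter_upwards [hbdd n] with ω hω
      obtain ⟨h1, h2⟩ := abs_le.1 hω
      rw [Finset.sum_range_succ, mul_add, Real.exp_add]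
      have hcv := convexOn_exp.2 (Set.mem_univ (-(l * c))) (Set.mem_univ (l * c))
        (show 0 ≤ (c - D n ω) / (2 * c) by apply div_nonneg <;> linarith)
        (show 0 ≤ (c + D n ω) / (2 * c) by apply div_nonneg <;> linarith)
        (by field_simp; ring)
      have e1 : ((c - D n ω) / (2 * c)) • (-(l * c)) + ((c + D n ω) / (2 * c)) • (l * c)
          = l * D n ω := by
        simp only [smul_eq_mul]; field_simp; ring
      rw [e1] at hcv
      have e2 : ((c - D n ω) / (2 * c)) • Real.exp (-(l * c))
          + ((c + D n ω) / (2 * c)) • Real.exp (l * c)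
          = Real.cosh (l * c) + Real.sinh (l * c) / c * D n ω := by
        rw [Real.cosh_eq, Real.sinh_eq]; simp only [smul_eq_mul]; field_simp; ring
      rw [e2] at hcv
      have := mul_le_mul_of_nonneg_left hcv (Real.exp_pos (l * ∑ t ∈ Finset.range n, D t ω)).le
      refine this.trans (le_of_eq ?_)
      simp only [hE, Pi.mul_apply]; ring
    have hcosh : Real.cosh (l * c) ≤ Real.exp (l ^ 2 * c ^ 2 / 2) := by
      have := Real.cosh_le_exp_half_sq (l * c)
      rwa [mul_pow] at this
    calc ∫ ω, Real.exp (l * ∑ t ∈ Finset.range (n + 1), D t ω) ∂P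
        ≤ ∫ ω, (Real.cosh (l * c) * E ω + Real.sinh (l * c) / c * (E * D n) ω) ∂P :=
          integral_mono_ae (hint (n + 1))
            (((hint n).const_mul _).add (hEDint.const_mul _)) hpt
      _ = Real.cosh (l * c) * ∫ ω, E ω ∂P := by
          rw [integral_add ((hint n).const_mul _) (hEDint.const_mul _), integral_const_mul,
            integral_const_mul, hz, mul_zero, add_zero]
      _ ≤ Real.exp (l ^ 2 * c ^ 2 / 2) * Real.exp (n * (l ^ 2 * c ^ 2 / 2)) := by
          have : 0 ≤ ∫ ω, E ω ∂P := integral_nonneg fun ω => (Real.exp_pos _).le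
          gcongr
      _ = Real.exp ((n + 1 : ℕ) * (l ^ 2 * c ^ 2 / 2)) := by
          rw [← Real.exp_add]; push_cast; congr 1; ring

/-- An Azuma-type bound with an explicit exponential parameter. -/
theorem measureReal_sum_martingaleDiff_ge_le {Ω : Type*} {m0 : MeasurableSpace Ω} {P : Measure Ω}
    [IsProbabilityMeasure P] {ℱ : ℕ → MeasurableSpace Ω} (hmono : Monotone ℱ) (hle : ∀ t, ℱ t ≤ m0)
    {D : ℕ → Ω → ℝ} (hmeas : ∀ t, StronglyMeasurable[ℱ (t + 1)] (D t)) {c : ℝ} (hc : 0 < c)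
    (hbdd : ∀ t, ∀ᵐ ω ∂P, |D t ω| ≤ c) (hzero : ∀ t, P[D t | ℱ t] =ᵐ[P] 0) {l δ : ℝ} (hl : 0 < l)
    (hδ : 0 < δ) (n : ℕ) :
    P.real {ω | Real.log (1 / δ) / l + n * (l * c ^ 2 / 2) ≤ ∑ t ∈ Finset.range n, D t ω} ≤ δ := by
  obtain ⟨hint, hI⟩ := integral_exp_sum_martingaleDiff_le hmono hle hmeas hc hbdd hzero l n
  have h := measure_ge_le_exp_mul_mgf (μ := P) (X := fun ω => ∑ t ∈ Finset.range n, D t ω)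
    (Real.log (1 / δ) / l + n * (l * c ^ 2 / 2)) hl.le hint
  -- The threshold is the value for which -l · threshold + n l² c²/2 equals log δ.
  refine h.trans ((mul_le_mul_of_nonneg_left hI (Real.exp_pos _).le).trans (le_of_eq ?_))
  rw [← Real.exp_add]
  conv_rhs => rw [← Real.exp_log hδ]
  congr 1
  rw [one_div, Real.log_inv]
  field_simp
  ring

/-! ### Mixing of products of the weights -/

/-- The product `W (s + k - 1) ⋯ W s` of the weights. -/
def transition {N : ℕ} (W : ℕ → Matrix (Fin N) (Fin N) ℝ) (s : ℕ) : ℕ → Matrix (Fin N) (Fin N) ℝ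
  | 0 => 1
  | k + 1 => W (s + k) * transition W s k

/-- The push-sum weights. -/
def pushWeight {N : ℕ} (W : ℕ → Matrix (Fin N) (Fin N) ℝ) : ℕ → Fin N → ℝ
  | 0 => fun _ => 1
  | t + 1 => fun i => ∑ j, W t i j * pushWeight W t j

namespace GraphAssumption

variable {N : ℕ} {W : ℕ → Matrix (Fin N) (Fin N) ℝ}

theorem transition_nonneg (hW : GraphAssumption W) (s k : ℕ) (i j : Fin N) :
    0 ≤ transition W s k i j := by
  induction k generalizing i j with
  | zero => simp only [transition, Matrix.one_apply]; split_ifs <;> norm_num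
  | succ k ih =>
    simp only [transition, Matrix.mul_apply]
    exact Finset.sum_nonneg fun l _ => mul_nonneg (hW.nonneg _ _ _) (ih l j)

theorem transition_succ_pos (hW : GraphAssumption W) {s k : ℕ} {i l j : Fin N}
    (h1 : 0 < W (s + k) i l) (h2 : 0 < transition W s k l j) : 0 < transition W s (k + 1) i j := by
  simp only [transition, Matrix.mul_apply]
  exact Finset.sum_pos' (fun l _ => mul_nonneg (hW.nonneg _ _ _) (hW.transition_nonneg s k l j))
    ⟨l, Finset.mem_univ _, mul_pos h1 h2⟩

theorem transition_pos_mono (hW : GraphAssumption W) {s k k' : ℕ} (hk : k ≤ k') {i j : Fin N}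
    (h : 0 < transition W s k i j) : 0 < transition W s k' i j := by
  induction k', hk using Nat.le_induction with
  | base => exact h
  | succ k' _ ih => exact hW.transition_succ_pos (hW.self_pos _ i) ih

/-- A positive entry comes from at least one walk of k active edges; the other terms are
nonnegative, and each edge of the walk contributes at least w. -/
theorem pow_le_transition (hW : GraphAssumption W) {w : ℝ} (hw : 0 < w)
    (hlow : ∀ t i j, 0 < W t i j → w ≤ W t i j) {s k : ℕ} {i j : Fin N}
    (h : 0 < transition W s k i j) : w ^ k ≤ transition W s k i j := by
  induction k generalizing i j with
  | zero =>
    simp only [transition, Matrix.one_apply] at h ⊢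
    split_ifs at h ⊢
    · simp
    · exact absurd h (lt_irrefl _)
  | succ k ih =>
    simp only [transition, Matrix.mul_apply] at h ⊢
    obtain ⟨l, -, hl⟩ := Finset.exists_lt_of_sum_lt (s := Finset.univ) (f := fun _ : Fin N => (0 : ℝ))
      (g := fun l => W (s + k) i l * transition W s k l j) (by simpa using h)
    have h1 : 0 < W (s + k) i l := (hW.nonneg _ _ _).lt_of_ne' (left_ne_zero_of_mul hl.ne')
    have h2 : 0 < transition W s k l j :=
      (hW.transition_nonneg _ _ _ _).lt_of_ne' (right_ne_zero_of_mul hl.ne')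
    calc w ^ (k + 1) = w * w ^ k := by ring
      _ ≤ W (s + k) i l * transition W s k l j :=
        mul_le_mul (hlow _ _ _ h1) (ih h2) (by positivity) h1.le
      _ ≤ _ := Finset.single_le_sum
        (f := fun l => W (s + k) i l * transition W s k l j)
        (fun l _ => mul_nonneg (hW.nonneg _ _ _) (hW.transition_nonneg s k l j)) (Finset.mem_univ l)

/-- Over a window of `k U` rounds every player reaches at least `min (k + 1) N` players. -/
theorem card_reach (hW : GraphAssumption W) {U : ℕ}
    (hU : ∀ t a b, Relation.ReflTransGen (fun j i => ∃ l < U, 0 < W (t + l) i j) a b)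
    (s k : ℕ) (j : Fin N) :
    min (k + 1) N ≤ (Finset.univ.filter fun i => 0 < transition W s (k * U) i j).card := by
  induction k with
  | zero =>
    refine (min_le_left _ _).trans ?_
    rw [Nat.zero_add, Nat.succ_le_iff, Finset.card_pos]
    exact ⟨j, by simp [transition]⟩
  | succ k ih =>
    set R := Finset.univ.filter fun i => 0 < transition W s (k * U) i j with hR
    set R' := Finset.univ.filter fun i => 0 < transition W s ((k + 1) * U) i j with hR'
    have hsub : R ⊆ R' := fun i hi => by
      simp only [hR, hR', Finset.mem_filter, Finset.mem_univ, true_and] at hi ⊢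
      exact hW.transition_pos_mono (by gcongr; omega) hi
    by_cases hfull : R = Finset.univ
    · have : R' = Finset.univ := Finset.univ_subset_iff.1 (hfull ▸ hsub)
      rw [this, Finset.card_univ, Fintype.card_fin]
      exact min_le_right _ _
    · have hj : j ∈ R := by
        simp only [hR, Finset.mem_filter, Finset.mem_univ, true_and]
        exact hW.transition_pos_mono (Nat.zero_le _) (by simp [transition])
      obtain ⟨b, hb⟩ : ∃ b, b ∉ R := by
        by_contra! h
        exact hfull (Finset.eq_univ_iff_forall.2 h)
      -- If no edge of the window left R, then R, which contains j, would contain everything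
      -- reachable from j, hence also b.
      have hedge : ∃ a ∈ R, ∃ c, c ∉ R ∧ ∃ l < U, 0 < W (s + k * U + l) c a := by
        by_contra! hno
        have : ∀ c, Relation.ReflTransGen (fun j i => ∃ l < U, 0 < W (s + k * U + l) i j) j c →
            c ∈ R := by
          intro c hc
          induction hc with
          | refl => exact hj
          | tail _ h ih2 =>
            by_contra hcR
            obtain ⟨l, hl, hpos⟩ := h
            exact absurd hpos (not_lt.2 (hno _ ih2 _ hcR l hl))
        exact hb (this b (hU _ _ _))
      obtain ⟨a, ha, c, hc, l, hl, hpos⟩ := hedge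
      have hcR' : c ∈ R' := by
        simp only [hR, hR', Finset.mem_filter, Finset.mem_univ, true_and] at ha ⊢
        have h1 : 0 < transition W s (k * U + l) a j := hW.transition_pos_mono (by omega) ha
        have h2 : 0 < transition W s (k * U + l + 1) c j :=
          hW.transition_succ_pos (by rwa [← add_assoc]) h1
        exact hW.transition_pos_mono (by rw [add_mul]; omega) h2
      have hlt : R.card < R'.card :=
        Finset.card_lt_card ⟨hsub, fun h => hc (h hcR')⟩
      have := min_le_left (k + 1 + 1) N
      rcases le_total (k + 1) N with h | h
      · rw [min_eq_left h] at ih; omega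
      · rw [min_eq_right h] at ih
        have := min_le_right (k + 1 + 1) N
        omega

/-- Some fixed number of rounds mixes: all entries of the products are bounded below. -/
theorem exists_mixing (hW : GraphAssumption W) :
    ∃ (L : ℕ) (η : ℝ), 0 < η ∧ (∀ s i j, η ≤ transition W s L i j) ∧
      ∀ s k i, k ≤ L → η ≤ transition W s k i i := by
  obtain ⟨w, hw, hw1, hlow⟩ := hW.lower
  obtain ⟨U, -, hU⟩ := hW.connected
  -- After N windows the count min(N + 1, N) is N, so every player has been reached. Diagonal
  -- entries are positive at all shorter times because of the self-loops.
  refine ⟨N * U, w ^ (N * U), by positivity, fun s i j => hW.pow_le_transition hw hlow ?_,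
    fun s k i hk => ?_⟩
  · have h := hW.card_reach hU s N j
    rw [min_eq_right (by omega)] at h
    have : (Finset.univ.filter fun i => 0 < transition W s (N * U) i j) = Finset.univ :=
      Finset.eq_univ_of_card _ (le_antisymm (Finset.card_le_univ _) (by simpa using h))
    have hi := Finset.mem_univ i
    rw [← this] at hi
    simpa using hi
  · refine (pow_le_pow_of_le_one hw.le hw1.le hk).trans (hW.pow_le_transition hw hlow ?_)
    exact hW.transition_pos_mono (Nat.zero_le _) (by simp [transition])

theorem sum_transition (hW : GraphAssumption W) (s k : ℕ) (j : Fin N) :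
    ∑ i, transition W s k i j = 1 := by
  induction k with
  | zero => simp [transition, Matrix.one_apply]
  | succ k ih =>
    simp only [transition, Matrix.mul_apply]
    rw [Finset.sum_comm]
    simp_rw [← Finset.sum_mul, hW.col_stochastic, one_mul]
    exact ih

theorem pushWeight_add (W : ℕ → Matrix (Fin N) (Fin N) ℝ) (s k : ℕ) (i : Fin N) :
    pushWeight W (s + k) i = ∑ j, transition W s k i j * pushWeight W s j := by
  induction k generalizing i with
  | zero => simp [transition, Matrix.one_apply]
  | succ k ih =>
    rw [← add_assoc]
    simp only [pushWeight, transition, Matrix.mul_apply, ih, Finset.mul_sum, Finset.sum_mul]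
    rw [Finset.sum_comm]
    simp only [mul_assoc]

theorem pushWeight_nonneg (hW : GraphAssumption W) (t : ℕ) (i : Fin N) : 0 ≤ pushWeight W t i := by
  induction t generalizing i with
  | zero => simp [pushWeight]
  | succ t ih => exact Finset.sum_nonneg fun j _ => mul_nonneg (hW.nonneg _ _ _) (ih j)

theorem sum_pushWeight (hW : GraphAssumption W) (t : ℕ) : ∑ i, pushWeight W t i = N := by
  induction t with
  | zero => simp [pushWeight]
  | succ t ih =>
    simp only [pushWeight]
    rw [Finset.sum_comm]
    simp_rw [← Finset.sum_mul, hW.col_stochastic, one_mul]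
    exact ih

theorem pushWeight_le (hW : GraphAssumption W) (t : ℕ) (i : Fin N) : pushWeight W t i ≤ N := by
  rw [← hW.sum_pushWeight t]
  exact Finset.single_le_sum (fun j _ => hW.pushWeight_nonneg t j) (Finset.mem_univ i)

/-- Up to time L the diagonal entry suffices; later, the last L rounds spread the total mass N over
all players, giving each at least ηN. -/
theorem exists_le_pushWeight (hW : GraphAssumption W) :
    ∃ η : ℝ, 0 < η ∧ ∀ t i, η ≤ pushWeight W t i := by
  obtain ⟨L, η, hη, hmix, hself⟩ := hW.exists_mixing
  refine ⟨η, hη, fun t i => ?_⟩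
  have hN : (1 : ℝ) ≤ N := by
    have : 0 < N := i.pos
    exact_mod_cast this
  rcases le_total t L with h | h
  · have e := pushWeight_add W 0 t i
    rw [zero_add] at e
    rw [e]
    refine (hself 0 t i h).trans ?_
    refine le_trans ?_ (Finset.single_le_sum (f := fun j => transition W 0 t i j * pushWeight W 0 j)
      (fun j _ => mul_nonneg (hW.transition_nonneg _ _ _ _) (hW.pushWeight_nonneg _ _))
      (Finset.mem_univ i))
    simp [pushWeight]
  · have e := pushWeight_add W (t - L) L i
    rw [Nat.sub_add_cancel h] at e
    rw [e]
    calc η ≤ η * N := le_mul_of_one_le_right hη.le hN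
      _ = ∑ j, η * pushWeight W (t - L) j := by rw [← Finset.mul_sum, hW.sum_pushWeight]
      _ ≤ _ := Finset.sum_le_sum fun j _ =>
        mul_le_mul_of_nonneg_right (hmix _ _ _) (hW.pushWeight_nonneg _ _)

end GraphAssumption

/-! ### ℓ¹ contraction and accumulated push-sum errors -/

section Contraction

variable {N : ℕ} {E : Type*} [NormedAddCommGroup E] [NormedSpace ℝ E]

theorem sum_norm_sum_smul_le {A : Matrix (Fin N) (Fin N) ℝ} (hA : ∀ i j, 0 ≤ A i j) {ρ : ℝ}
    (hcol : ∀ j, ∑ i, A i j ≤ ρ) (y : Fin N → E) :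
    ∑ i, ‖∑ j, A i j • y j‖ ≤ ρ * ∑ j, ‖y j‖ := by
  calc ∑ i, ‖∑ j, A i j • y j‖ ≤ ∑ i, ∑ j, A i j * ‖y j‖ := by
        refine Finset.sum_le_sum fun i _ => (norm_sum_le _ _).trans (le_of_eq ?_)
        refine Finset.sum_congr rfl fun j _ => ?_
        rw [norm_smul, Real.norm_of_nonneg (hA i j)]
    _ = ∑ j, (∑ i, A i j) * ‖y j‖ := by
        rw [Finset.sum_comm]; simp_rw [Finset.sum_mul]
    _ ≤ ∑ j, ρ * ‖y j‖ :=
        Finset.sum_le_sum fun j _ => mul_le_mul_of_nonneg_right (hcol j) (norm_nonneg _)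
    _ = _ := by rw [Finset.mul_sum]

/-- The `ℓ¹` contraction of a positive column stochastic matrix on vectors with sum zero. -/
theorem sum_norm_sum_smul_le_of_sum_eq_zero {A : Matrix (Fin N) (Fin N) ℝ} {η : ℝ}
    (hA : ∀ i j, η ≤ A i j) (hcol : ∀ j, ∑ i, A i j = 1) {y : Fin N → E} (hy : ∑ j, y j = 0) :
    ∑ i, ‖∑ j, A i j • y j‖ ≤ (1 - N * η) * ∑ j, ‖y j‖ := by
  -- Subtracting η from every entry does not change the action on zero-sum vectors and leaves a
  -- nonnegative matrix with column sums 1 - Nη.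
  have h := sum_norm_sum_smul_le (A := fun i j => A i j - η) (fun i j => sub_nonneg.2 (hA i j))
    (ρ := 1 - N * η) (fun j => by simp [Finset.sum_sub_distrib, hcol j]) y
  simpa [sub_smul, Finset.sum_sub_distrib, ← Finset.smul_sum, hy] using h

namespace GraphAssumption

variable {W : ℕ → Matrix (Fin N) (Fin N) ℝ}

theorem sum_norm_mix_le (hW : GraphAssumption W) (t : ℕ) (y : Fin N → E) :
    ∑ i, ‖∑ j, W t i j • y j‖ ≤ ∑ j, ‖y j‖ := by
  simpa using sum_norm_sum_smul_le (hW.nonneg t) (fun j => (hW.col_stochastic t j).le) y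

theorem sum_mix (hW : GraphAssumption W) (t : ℕ) (y : Fin N → E) :
    ∑ i, ∑ j, W t i j • y j = ∑ j, y j := by
  rw [Finset.sum_comm]
  simp_rw [← Finset.sum_smul, hW.col_stochastic, one_smul]

/-- Mixing never increases the ℓ¹ norm, so earlier perturbations are not amplified and simply add
up. -/
theorem sum_norm_sub_transition_le (hW : GraphAssumption W) {y : ℕ → Fin N → E} {b : ℕ → ℝ}
    (hstep : ∀ t, ∑ i, ‖y (t + 1) i - ∑ j, W t i j • y t j‖ ≤ b t) (s k : ℕ) :
    ∑ i, ‖y (s + k) i - ∑ j, transition W s k i j • y s j‖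
      ≤ ∑ l ∈ Finset.range k, b (s + l) := by
  induction k with
  | zero => simp [transition, Matrix.one_apply]
  | succ k ih =>
    rw [Finset.sum_range_succ]
    have e : ∀ i, y (s + (k + 1)) i - ∑ j, transition W s (k + 1) i j • y s j
        = (∑ j, W (s + k) i j • (y (s + k) j - ∑ l, transition W s k j l • y s l))
          + (y (s + k + 1) i - ∑ j, W (s + k) i j • y (s + k) j) := by
      intro i
      have e1 : ∑ j, transition W s (k + 1) i j • y s j
          = ∑ j, W (s + k) i j • ∑ l, transition W s k j l • y s l := by
        simp only [transition, Matrix.mul_apply, Finset.sum_smul, Finset.smul_sum, mul_smul]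
        rw [Finset.sum_comm]
      rw [e1]
      simp only [smul_sub, Finset.sum_sub_distrib, add_assoc]
      abel
    calc _ ≤ ∑ i, (‖∑ j, W (s + k) i j • (y (s + k) j - ∑ l, transition W s k j l • y s l)‖
          + ‖y (s + k + 1) i - ∑ j, W (s + k) i j • y (s + k) j‖) :=
          Finset.sum_le_sum fun i _ => by rw [e i]; exact norm_add_le _ _
      _ ≤ _ := by
          rw [Finset.sum_add_distrib]
          exact add_le_add ((hW.sum_norm_mix_le _ _).trans ih) (hstep _)

/-- Zero-sum vectors that are mixed and perturbed have summable size if the perturbations do. -/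
theorem exists_sum_norm_le (hN : 0 < N) (hW : GraphAssumption W) :
    ∃ B : ℝ, 0 < B ∧ ∀ (y : ℕ → Fin N → E) (b : ℕ → ℝ), (∀ t, ∑ i, y t i = 0) → Antitone b →
      (∀ t, ∑ i, ‖y (t + 1) i - ∑ j, W t i j • y t j‖ ≤ b t) → ∀ T,
      ∑ t ∈ Finset.range T, ∑ i, ‖y t i‖
        ≤ B * (∑ i, ‖y 0 i‖ + b 0 + ∑ t ∈ Finset.range T, b t) := by
  obtain ⟨L, η, hη, hmix, -⟩ := hW.exists_mixing
  have hNη : 0 < N * η := mul_pos (by exact_mod_cast hN) hη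
  refine ⟨(L + L * L + 1) / (N * η), by positivity, fun y b hy hb hstep T => ?_⟩
  have hb0 : ∀ t, 0 ≤ b t := fun t => (Finset.sum_nonneg fun i _ => norm_nonneg _).trans (hstep t)
  set Y : ℕ → ℝ := fun t => ∑ i, ‖y t i‖ with hY
  have hY0 : ∀ t, 0 ≤ Y t := fun t => Finset.sum_nonneg fun i _ => norm_nonneg _
  have h1 : ∀ t, Y (t + 1) ≤ Y t + b t := by
    intro t
    have : Y (t + 1) ≤ ∑ i, (‖∑ j, W t i j • y t j‖ + ‖y (t + 1) i - ∑ j, W t i j • y t j‖) :=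
      Finset.sum_le_sum fun i _ => by
        simpa using norm_add_le (∑ j, W t i j • y t j) (y (t + 1) i - ∑ j, W t i j • y t j)
    rw [Finset.sum_add_distrib] at this
    linarith [hW.sum_norm_mix_le t (y t), hstep t]
  have h2 : ∀ k, Y k ≤ Y 0 + k * b 0 := by
    intro k
    induction k with
    | zero => simp
    | succ k ih => push_cast; linarith [h1 k, hb (Nat.zero_le k)]
  have h3 : ∀ t, Y (t + L) ≤ (1 - N * η) * Y t + L * b t := by
    intro t
    have : Y (t + L) ≤ ∑ i, (‖∑ j, transition W t L i j • y t j‖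
        + ‖y (t + L) i - ∑ j, transition W t L i j • y t j‖) :=
      Finset.sum_le_sum fun i _ => by
        simpa using norm_add_le (∑ j, transition W t L i j • y t j)
          (y (t + L) i - ∑ j, transition W t L i j • y t j)
    rw [Finset.sum_add_distrib] at this
    have h4 := sum_norm_sum_smul_le_of_sum_eq_zero (hmix t) (hW.sum_transition t L) (hy t)
    have h5 := hW.sum_norm_sub_transition_le hstep t L
    have h6 : ∑ l ∈ Finset.range L, b (t + l) ≤ L * b t := by
      refine (Finset.sum_le_sum fun l _ => hb (Nat.le_add_right t l)).trans (by simp)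
    linarith
  -- The L-step contraction `h3` is summed over t instead of iterated. The sliding window of L terms
  -- acts as a potential, so no geometric series is needed.
  have hwin : ∀ T, N * η * ∑ t ∈ Finset.range T, Y t + ∑ k ∈ Finset.range L, Y (T + k)
      ≤ ∑ k ∈ Finset.range L, Y k + L * ∑ t ∈ Finset.range T, b t := by
    intro T
    induction T with
    | zero => simp
    | succ T ih =>
      have e : ∑ k ∈ Finset.range L, Y (T + 1 + k) + Y T = ∑ k ∈ Finset.range L, Y (T + k) + Y (T + L) := by
        rw [← Finset.sum_range_succ (fun k => Y (T + k)), Finset.sum_range_succ' (fun k => Y (T + k))]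
        simp only [add_zero, add_assoc, add_comm 1]
      rw [Finset.sum_range_succ, Finset.sum_range_succ]
      linarith [h3 T]
  have hinit : ∑ k ∈ Finset.range L, Y k ≤ L * (Y 0 + L * b 0) := by
    have : ∀ k ∈ Finset.range L, Y k ≤ Y 0 + L * b 0 := fun k hk => (h2 k).trans (by
      have : (k : ℝ) ≤ L := by exact_mod_cast (Finset.mem_range.1 hk).le
      nlinarith [hb0 0])
    exact (Finset.sum_le_sum this).trans (by rw [Finset.sum_const, Finset.card_range, nsmul_eq_mul])
  have hpos : 0 ≤ ∑ k ∈ Finset.range L, Y (T + k) := Finset.sum_nonneg fun k _ => hY0 _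
  have hsb : 0 ≤ ∑ t ∈ Finset.range T, b t := Finset.sum_nonneg fun t _ => hb0 t
  rw [div_mul_eq_mul_div, le_div_iff₀ hNη]
  have hL : (0 : ℝ) ≤ L := Nat.cast_nonneg L
  have := hwin T
  nlinarith [hb0 0, hY0 0, mul_nonneg hL (hY0 0), mul_nonneg hL (hb0 0), mul_nonneg hL hsb,
    mul_nonneg (mul_nonneg hL hL) (hY0 0), mul_nonneg (mul_nonneg hL hL) (hb0 0),
    mul_nonneg (mul_nonneg hL hL) hsb]

/-- Accumulated tracking error of push-sum averaging. -/
theorem exists_sum_pushSum_error_le (hN : 0 < N) (hW : GraphAssumption W) :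
    ∃ B : ℝ, 0 < B ∧ ∀ (v : ℕ → Fin N → E) (b : ℕ → ℝ), Antitone b →
      (∀ t, ∑ i, ‖v (t + 1) i - ∑ j, W t i j • v t j‖ ≤ b t) → ∀ T,
      ∑ t ∈ Finset.range T, ∑ i, ‖(pushWeight W (t + 1) i)⁻¹ • (∑ j, W t i j • v t j)
          - (1 / (N : ℝ)) • ∑ j, v t j‖
        ≤ B * (∑ i, ‖v 0 i‖ + b 0 + ∑ t ∈ Finset.range T, b t) := by
  obtain ⟨B, hB, hmain⟩ := hW.exists_sum_norm_le (E := E) hN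
  obtain ⟨η, hη, hz⟩ := hW.exists_le_pushWeight
  refine ⟨η⁻¹ * (B * 2), by positivity, fun v b hb hstep T => ?_⟩
  have hN' : (N : ℝ) ≠ 0 := by exact_mod_cast hN.ne'
  set vbar : ℕ → E := fun t => (1 / (N : ℝ)) • ∑ j, v t j with hvbar
  -- Subtracting the mean in proportion to the push-sum weights gives zero-sum vectors, and mixing y
  -- yields exactly the estimation error times the next weight.
  set y : ℕ → Fin N → E := fun t i => v t i - pushWeight W t i • vbar t with hy
  have hmixy : ∀ t i, ∑ j, W t i j • y t j
      = ∑ j, W t i j • v t j - pushWeight W (t + 1) i • vbar t := by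
    intro t i
    simp only [hy, smul_sub, Finset.sum_sub_distrib, pushWeight, Finset.sum_smul, mul_smul]
  have hzw : ∀ t, ∑ i, ‖pushWeight W t i • vbar t‖ ≤ ∑ i, ‖v t i‖ := by
    intro t
    simp_rw [norm_smul]
    rw [← Finset.sum_mul]
    have : ∑ i, ‖pushWeight W t i‖ = N := by
      rw [← hW.sum_pushWeight t]
      exact Finset.sum_congr rfl fun i _ => Real.norm_of_nonneg (hW.pushWeight_nonneg t i)
    rw [this, hvbar]
    simp only [norm_smul, norm_div, norm_one, RCLike.norm_natCast]
    rw [← mul_assoc, mul_one_div_cancel hN', one_mul]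
    exact norm_sum_le _ _
  have hsum : ∀ t, ∑ i, y t i = 0 := by
    intro t
    simp only [hy, Finset.sum_sub_distrib, ← Finset.sum_smul, hW.sum_pushWeight, hvbar]
    rw [smul_smul, mul_one_div_cancel hN', one_smul, sub_self]
  -- The factor 2: one share for the perturbation itself, one for the resulting shift of the mean.
  have hstepy : ∀ t, ∑ i, ‖y (t + 1) i - ∑ j, W t i j • y t j‖ ≤ 2 * b t := by
    intro t
    set e : Fin N → E := fun i => v (t + 1) i - ∑ j, W t i j • v t j with he
    have hve : vbar (t + 1) - vbar t = (1 / (N : ℝ)) • ∑ i, e i := by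
      simp only [hvbar, he, Finset.sum_sub_distrib, hW.sum_mix, smul_sub]
    have e1 : ∀ i, y (t + 1) i - ∑ j, W t i j • y t j
        = e i - pushWeight W (t + 1) i • ((1 / (N : ℝ)) • ∑ i, e i) := by
      intro i
      rw [hmixy, ← hve, smul_sub]
      simp only [hy, he]
      abel
    have h1 : ∑ i, ‖pushWeight W (t + 1) i • ((1 / (N : ℝ)) • ∑ i, e i)‖ ≤ ∑ i, ‖e i‖ := by
      simp_rw [norm_smul]
      rw [← Finset.sum_mul]
      have : ∑ i, ‖pushWeight W (t + 1) i‖ = N := by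
        rw [← hW.sum_pushWeight (t + 1)]
        exact Finset.sum_congr rfl fun i _ => Real.norm_of_nonneg (hW.pushWeight_nonneg _ i)
      rw [this]
      simp only [norm_div, norm_one, RCLike.norm_natCast]
      rw [← mul_assoc, mul_one_div_cancel hN', one_mul]
      exact norm_sum_le _ _
    calc _ ≤ ∑ i, (‖e i‖ + ‖pushWeight W (t + 1) i • ((1 / (N : ℝ)) • ∑ i, e i)‖) :=
          Finset.sum_le_sum fun i _ => by rw [e1 i]; exact norm_sub_le _ _
      _ ≤ 2 * b t := by
          rw [Finset.sum_add_distrib]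
          linarith [hstep t]
  have hmain' := hmain y (fun t => 2 * b t) hsum
    (fun s t h => mul_le_mul_of_nonneg_left (hb h) zero_le_two) hstepy T
  have hy0 : ∑ i, ‖y 0 i‖ ≤ 2 * ∑ i, ‖v 0 i‖ := by
    calc ∑ i, ‖y 0 i‖ ≤ ∑ i, (‖v 0 i‖ + ‖pushWeight W 0 i • vbar 0‖) :=
          Finset.sum_le_sum fun i _ => norm_sub_le _ _
      _ ≤ _ := by rw [Finset.sum_add_distrib]; linarith [hzw 0]
  have herr : ∀ t, ∑ i, ‖(pushWeight W (t + 1) i)⁻¹ • (∑ j, W t i j • v t j) - vbar t‖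
      ≤ η⁻¹ * ∑ i, ‖y t i‖ := by
    intro t
    calc _ ≤ ∑ i, η⁻¹ * ‖∑ j, W t i j • y t j‖ := by
          refine Finset.sum_le_sum fun i _ => ?_
          have hzi := hη.trans_le (hz (t + 1) i)
          have : (pushWeight W (t + 1) i)⁻¹ • (∑ j, W t i j • v t j) - vbar t
              = (pushWeight W (t + 1) i)⁻¹ • ∑ j, W t i j • y t j := by
            rw [hmixy, smul_sub, smul_smul, inv_mul_cancel₀ hzi.ne', one_smul]
          rw [this, norm_smul, norm_inv, Real.norm_of_nonneg hzi.le]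
          gcongr
          exact hz _ _
      _ ≤ _ := by
          rw [← Finset.mul_sum]
          exact mul_le_mul_of_nonneg_left (hW.sum_norm_mix_le t (y t)) (inv_nonneg.2 hη.le)
  calc _ ≤ ∑ t ∈ Finset.range T, η⁻¹ * ∑ i, ‖y t i‖ := Finset.sum_le_sum fun t _ => herr t
    _ = η⁻¹ * ∑ t ∈ Finset.range T, ∑ i, ‖y t i‖ := by rw [Finset.mul_sum]
    _ ≤ η⁻¹ * (B * (2 * ∑ i, ‖v 0 i‖ + 2 * b 0 + ∑ t ∈ Finset.range T, 2 * b t)) := by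
        gcongr
        refine hmain'.trans ?_
        gcongr
    _ = _ := by rw [← Finset.mul_sum]; ring

end GraphAssumption
end Contraction

/-! ### Estimates, means and stepsize conditions -/

/-- The push-sum estimate of the mean of the components of `v t`. -/
noncomputable def pushSumEstimate {N : ℕ} {E : Type*} [AddCommGroup E] [Module ℝ E]
    (W : ℕ → Matrix (Fin N) (Fin N) ℝ) (v : ℕ → Fin N → E) (t : ℕ) (i : Fin N) : E :=
  (pushWeight W (t + 1) i)⁻¹ • ∑ j, W t i j • v t j

/-- The mean of the components of `v t`. -/
noncomputable def playerMean {N : ℕ} {E : Type*} [AddCommGroup E] [Module ℝ E] (v : ℕ → Fin N → E) (t : ℕ) : E :=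
  (1 / (N : ℝ)) • ∑ j, v t j

/-- Qualitative properties of the stepsizes. -/
structure StepSizes (α β γ : ℕ → ℝ) : Prop where
  α_pos : ∀ t, 0 < α t
  β_pos : ∀ t, 0 < β t
  γ_pos : ∀ t, 0 < γ t
  β_le_one : ∀ t, β t ≤ 1
  γ_le_one : ∀ t, γ t ≤ 1
  α_anti : Antitone α
  β_anti : Antitone β
  γ_anti : Antitone γ
  αβ_anti : Antitone fun t => α t / β t

theorem inner_gradMap {k l : ℕ} (h : Euc k → Euc l) (x u : Euc k) (v : Euc l) :
    inner ℝ (gradMap h x v) u = inner ℝ v (fderiv ℝ h x u) := by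
  rw [gradMap, ContinuousLinearMap.adjoint_inner_left]

theorem norm_sub_smul_sq_le {k : ℕ} {a s : Euc k} {α K : ℝ} (hs : ‖s‖ ≤ K) :
    ‖a - α • s‖ ^ 2 ≤ ‖a‖ ^ 2 - 2 * α * inner ℝ s a + α ^ 2 * K ^ 2 := by
  rw [norm_sub_sq_real, norm_smul, inner_smul_right, mul_pow, Real.norm_eq_abs, sq_abs,
    real_inner_comm]
  have : ‖s‖ ^ 2 ≤ K ^ 2 := by gcongr
  nlinarith [mul_le_mul_of_nonneg_left this (sq_nonneg α)]

/-! ### One-step analysis along a sample path -/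

namespace AggGame

variable {N n m : ℕ} {d r : Fin N → ℕ} {Γ : AggGame N n m d r}

namespace SetAssumption

theorem exists_diam (h : Γ.SetAssumption) :
    ∃ D > 0, ∀ i, ∀ x ∈ Γ.X i, ∀ y ∈ Γ.X i, ‖x - y‖ ≤ D := by
  have : ∀ i, ∃ D, ∀ x ∈ Γ.X i, ∀ y ∈ Γ.X i, ‖x - y‖ ≤ D := fun i => by
    obtain ⟨C, hC⟩ := Metric.isBounded_iff.1 (h.compact i).isBounded
    exact ⟨C, fun x hx y hy => by simpa [dist_eq_norm] using hC hx hy⟩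
  choose D hD using this
  refine ⟨1 + ∑ i, |D i|, by positivity, fun i x hx y hy => (hD i x hx y hy).trans ?_⟩
  have := Finset.single_le_sum (f := fun i => |D i|) (fun i _ => abs_nonneg _) (Finset.mem_univ i)
  linarith [le_abs_self (D i)]

theorem continuousOn_g (h : Γ.SetAssumption) (i : Fin N) : ContinuousOn (Γ.g i) (Γ.X i) :=
  fun x hx => (h.g_diff i x hx).continuousAt.continuousWithinAt

theorem continuousOn_ψ (h : Γ.SetAssumption) (i : Fin N) : ContinuousOn (Γ.ψ i) (Γ.X i) :=
  fun x hx => (h.ψ_diff i x hx).continuousAt.continuousWithinAt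

theorem exists_norm_g_le (h : Γ.SetAssumption) :
    ∃ M > 0, ∀ i, ∀ x ∈ Γ.X i, ‖Γ.g i x‖ ≤ M := by
  have : ∀ i, ∃ D, ∀ x ∈ Γ.X i, ‖Γ.g i x‖ ≤ D :=
    fun i => (h.compact i).exists_bound_of_continuousOn (h.continuousOn_g i)
  choose D hD using this
  refine ⟨1 + ∑ i, |D i|, by positivity, fun i x hx => (hD i x hx).trans ?_⟩
  have := Finset.single_le_sum (f := fun i => |D i|) (fun i _ => abs_nonneg _) (Finset.mem_univ i)
  linarith [le_abs_self (D i)]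

end SetAssumption

/-- The sequences produced by the algorithm, for given sampled gradients `Q`. -/
structure IsTrajectory (Γ : AggGame N n m d r) (W : ℕ → Matrix (Fin N) (Fin N) ℝ) (α β γ : ℕ → ℝ)
    (x0 : ∀ i, Euc (d i)) (Q x : ℕ → ∀ i, Euc (d i)) (mu : ℕ → Fin N → Euc m)
    (sigma : ℕ → Fin N → Euc n) : Prop where
  x_zero : x 0 = x0
  mu_zero : ∀ i, mu 0 i = 0
  sigma_zero : ∀ i, sigma 0 i = Γ.ψ i (x0 i)
  x_succ : ∀ t i, x (t + 1) i = proj (Γ.X i) (x t i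
    - α t • (Q t i + gradMap (Γ.g i) (x t i) (pushSumEstimate W mu t i)))
  mu_succ : ∀ t i, mu (t + 1) i = posPartVec ((∑ j, W t i j • mu t j)
    + γ t • (Γ.g i (x t i) - β t • ∑ j, W t i j • mu t j))
  sigma_succ : ∀ t i, sigma (t + 1) i
    = (∑ j, W t i j • sigma t j) + Γ.ψ i (x (t + 1) i) - Γ.ψ i (x t i)

namespace IsTrajectory

variable {W : ℕ → Matrix (Fin N) (Fin N) ℝ} {α β γ : ℕ → ℝ} {x0 : ∀ i, Euc (d i)}
  {Q x : ℕ → ∀ i, Euc (d i)} {mu : ℕ → Fin N → Euc m} {sigma : ℕ → Fin N → Euc n}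

theorem x_mem (h : Γ.IsTrajectory W α β γ x0 Q x mu sigma) (hset : Γ.SetAssumption)
    (hx0 : ∀ i, x0 i ∈ Γ.X i) (t : ℕ) (i : Fin N) : x t i ∈ Γ.X i := by
  cases t with
  | zero => rw [h.x_zero]; exact hx0 i
  | succ t => rw [h.x_succ]; exact (proj_spec (hset.nonempty i) (hset.compact i) _).1

theorem mu_nonneg (h : Γ.IsTrajectory W α β γ x0 Q x mu sigma) (t : ℕ) (i : Fin N) (j : Fin m) :
    0 ≤ mu t i j := by
  cases t with
  | zero => rw [h.mu_zero]; simp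
  | succ t => rw [h.mu_succ]; exact posPartVec_nonneg _ _

theorem mix_mu_nonneg (h : Γ.IsTrajectory W α β γ x0 Q x mu sigma) (hW : GraphAssumption W)
    (t : ℕ) (i : Fin N) (k : Fin m) : 0 ≤ (∑ j, W t i j • mu t j) k := by
  simp only [WithLp.ofLp_sum, WithLp.ofLp_smul, Finset.sum_apply, Pi.smul_apply, smul_eq_mul]
  exact Finset.sum_nonneg fun j _ => mul_nonneg (hW.nonneg t i j) (h.mu_nonneg t j k)

theorem estimate_mu_nonneg (h : Γ.IsTrajectory W α β γ x0 Q x mu sigma) (hW : GraphAssumption W)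
    (t : ℕ) (i : Fin N) (k : Fin m) : 0 ≤ pushSumEstimate W mu t i k := by
  rw [pushSumEstimate, PiLp.smul_apply, smul_eq_mul]
  exact mul_nonneg (inv_nonneg.2 (hW.pushWeight_nonneg _ _)) (h.mix_mu_nonneg hW t i k)

theorem mean_mu_nonneg (h : Γ.IsTrajectory W α β γ x0 Q x mu sigma)
    (t : ℕ) (k : Fin m) : 0 ≤ playerMean mu t k := by
  simp only [playerMean, WithLp.ofLp_sum, WithLp.ofLp_smul, Finset.sum_apply, Pi.smul_apply,
    smul_eq_mul]
  exact mul_nonneg (by positivity) (Finset.sum_nonneg fun j _ => h.mu_nonneg t j k)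

/-- The level NM/β_t is a fixed point of the damped recursion s ↦ (1 - γ_t β_t) s + N γ_t M, and it
rises with t because β is antitone. -/
theorem sum_norm_mu_le (h : Γ.IsTrajectory W α β γ x0 Q x mu sigma) (hset : Γ.SetAssumption)
    (hx0 : ∀ i, x0 i ∈ Γ.X i) (hW : GraphAssumption W) (hs : StepSizes α β γ) {M : ℝ} (hM : 0 < M)
    (hg : ∀ i, ∀ x ∈ Γ.X i, ‖Γ.g i x‖ ≤ M) (t : ℕ) : ∑ i, ‖mu t i‖ ≤ N * M / β t := by
  induction t with
  | zero => simp only [h.mu_zero, norm_zero, Finset.sum_const_zero]; have := hs.β_pos 0; positivity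
  | succ t ih =>
    have hβ := hs.β_pos t
    have hγ := hs.γ_pos t
    have hc : 0 ≤ 1 - γ t * β t := by nlinarith [hs.β_le_one t, hs.γ_le_one t]
    have h1 : ∀ i, ‖mu (t + 1) i‖ ≤ (1 - γ t * β t) * ‖∑ j, W t i j • mu t j‖ + γ t * M := by
      intro i
      rw [h.mu_succ]
      refine (norm_posPartVec_le _).trans ?_
      have e : (∑ j, W t i j • mu t j) + γ t • (Γ.g i (x t i) - β t • ∑ j, W t i j • mu t j)
          = (1 - γ t * β t) • (∑ j, W t i j • mu t j) + γ t • Γ.g i (x t i) := by module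
      rw [e]
      refine (norm_add_le _ _).trans ?_
      rw [norm_smul, norm_smul, Real.norm_of_nonneg hc, Real.norm_of_nonneg hγ.le]
      gcongr
      exact hg i _ (h.x_mem hset hx0 t i)
    calc ∑ i, ‖mu (t + 1) i‖
        ≤ ∑ i, ((1 - γ t * β t) * ‖∑ j, W t i j • mu t j‖ + γ t * M) :=
          Finset.sum_le_sum fun i _ => h1 i
      _ = (1 - γ t * β t) * ∑ i, ‖∑ j, W t i j • mu t j‖ + N * (γ t * M) := by
          rw [Finset.sum_add_distrib, ← Finset.mul_sum]; simp
      _ ≤ (1 - γ t * β t) * (N * M / β t) + N * (γ t * M) :=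
          add_le_add_left (mul_le_mul_of_nonneg_left ((hW.sum_norm_mix_le t (mu t)).trans ih) hc) _
      _ = N * M / β t := by field_simp; ring
      _ ≤ N * M / β (t + 1) :=
          div_le_div_of_nonneg_left (by positivity) (hs.β_pos _) (hs.β_anti (Nat.le_succ t))

theorem norm_mix_mu_le (h : Γ.IsTrajectory W α β γ x0 Q x mu sigma) (hset : Γ.SetAssumption)
    (hx0 : ∀ i, x0 i ∈ Γ.X i) (hW : GraphAssumption W) (hs : StepSizes α β γ) {M : ℝ} (hM : 0 < M)
    (hg : ∀ i, ∀ x ∈ Γ.X i, ‖Γ.g i x‖ ≤ M) (t : ℕ) (i : Fin N) :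
    ‖∑ j, W t i j • mu t j‖ ≤ N * M / β t :=
  (Finset.single_le_sum (f := fun i => ‖∑ j, W t i j • mu t j‖) (fun _ _ => norm_nonneg _)
    (Finset.mem_univ i)).trans
    ((hW.sum_norm_mix_le t (mu t)).trans (h.sum_norm_mu_le hset hx0 hW hs hM hg t))

/-- The factor β_t compensates the multiplier size 1/β_t, so dual increments are of order γ_t. -/
theorem norm_constraint_residual_le (h : Γ.IsTrajectory W α β γ x0 Q x mu sigma)
    (hset : Γ.SetAssumption) (hx0 : ∀ i, x0 i ∈ Γ.X i) (hW : GraphAssumption W)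
    (hs : StepSizes α β γ) {M : ℝ} (hM : 0 < M) (hg : ∀ i, ∀ x ∈ Γ.X i, ‖Γ.g i x‖ ≤ M)
    (t : ℕ) (i : Fin N) :
    ‖Γ.g i (x t i) - β t • ∑ j, W t i j • mu t j‖ ≤ (N + 1) * M := by
  refine (norm_sub_le _ _).trans ?_
  rw [norm_smul, Real.norm_of_nonneg (hs.β_pos t).le]
  have h1 := mul_le_mul_of_nonneg_left (h.norm_mix_mu_le hset hx0 hW hs hM hg t i) (hs.β_pos t).le
  rw [mul_div_cancel₀ _ (hs.β_pos t).ne'] at h1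
  linarith [hg i _ (h.x_mem hset hx0 t i)]

theorem norm_mu_increment_le (h : Γ.IsTrajectory W α β γ x0 Q x mu sigma)
    (hset : Γ.SetAssumption) (hx0 : ∀ i, x0 i ∈ Γ.X i) (hW : GraphAssumption W)
    (hs : StepSizes α β γ) {M : ℝ} (hM : 0 < M) (hg : ∀ i, ∀ x ∈ Γ.X i, ‖Γ.g i x‖ ≤ M)
    (t : ℕ) (i : Fin N) :
    ‖mu (t + 1) i - ∑ j, W t i j • mu t j‖ ≤ γ t * ((N + 1) * M) := by
  rw [h.mu_succ]
  have h1 := norm_posPartVec_sub_le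
    ((∑ j, W t i j • mu t j) + γ t • (Γ.g i (x t i) - β t • ∑ j, W t i j • mu t j))
    (∑ j, W t i j • mu t j)
  rw [posPartVec_of_nonneg (h.mix_mu_nonneg hW t i), add_sub_cancel_left, norm_smul,
    Real.norm_of_nonneg (hs.γ_pos t).le] at h1
  exact h1.trans (mul_le_mul_of_nonneg_left
    (h.norm_constraint_residual_le hset hx0 hW hs hM hg t i) (hs.γ_pos t).le)

/-- The local multiplier is of order 1/β_t; its square, times α_t, is the source of the ratio
α_t/β_t² in the final bound. -/
theorem norm_direction_le (h : Γ.IsTrajectory W α β γ x0 Q x mu sigma)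
    (hset : Γ.SetAssumption) (hx0 : ∀ i, x0 i ∈ Γ.X i) (hW : GraphAssumption W)
    (hs : StepSizes α β γ) {M : ℝ} (hM : 0 < M) (hg : ∀ i, ∀ x ∈ Γ.X i, ‖Γ.g i x‖ ≤ M)
    {η : ℝ} (hη : 0 < η) (hz : ∀ t i, η ≤ pushWeight W t i) {M' : ℝ} (hM' : 0 ≤ M')
    (hg' : ∀ i, ∀ x ∈ Γ.X i, ‖gradMap (Γ.g i) x‖ ≤ M') {S : ℝ} (hS : 0 ≤ S)
    (t : ℕ) (i : Fin N) (hQ : ‖Q t i‖ ≤ S) :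
    ‖Q t i + gradMap (Γ.g i) (x t i) (pushSumEstimate W mu t i)‖
      ≤ (S + M' * (η⁻¹ * (N * M))) / β t := by
  have hβ := hs.β_pos t
  have h1 : ‖pushSumEstimate W mu t i‖ ≤ η⁻¹ * (N * M / β t) := by
    rw [pushSumEstimate, norm_smul, norm_inv, Real.norm_of_nonneg (hη.le.trans (hz _ _))]
    exact mul_le_mul (inv_anti₀ hη (hz _ _)) (h.norm_mix_mu_le hset hx0 hW hs hM hg t i)
      (norm_nonneg _) (by positivity)
  have h2 : ‖gradMap (Γ.g i) (x t i) (pushSumEstimate W mu t i)‖ ≤ M' * (η⁻¹ * (N * M / β t)) :=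
    (ContinuousLinearMap.le_opNorm _ _).trans
      (mul_le_mul (hg' i _ (h.x_mem hset hx0 t i)) h1 (norm_nonneg _) hM')
  have h3 : S ≤ S / β t := le_div_self hS hβ (hs.β_le_one t)
  refine (norm_add_le _ _).trans ?_
  rw [add_div]
  have e : M' * (η⁻¹ * (N * M)) / β t = M' * (η⁻¹ * (N * M / β t)) := by ring
  linarith

/-- The tracking invariant: mixing preserves the sum, and the correction adds exactly the change of
ψ. -/
theorem mean_sigma (h : Γ.IsTrajectory W α β γ x0 Q x mu sigma) (hW : GraphAssumption W) (t : ℕ) :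
    playerMean sigma t = Γ.agg (x t) := by
  rw [playerMean, agg]
  congr 1
  induction t with
  | zero => simp [h.sigma_zero, h.x_zero]
  | succ t ih =>
    simp_rw [h.sigma_succ, Finset.sum_sub_distrib, Finset.sum_add_distrib, hW.sum_mix, ih]
    abel

/-- The progress of one dual step. -/
theorem dual_step (h : Γ.IsTrajectory W α β γ x0 Q x mu sigma) (hN : 0 < N)
    (hset : Γ.SetAssumption) (hx0 : ∀ i, x0 i ∈ Γ.X i) (hW : GraphAssumption W)
    (hs : StepSizes α β γ) {M : ℝ} (hM : 0 < M) (hg : ∀ i, ∀ x ∈ Γ.X i, ‖Γ.g i x‖ ≤ M)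
    {η : ℝ} (hη : 0 < η) (hz : ∀ t i, η ≤ pushWeight W t i) {lam : Euc m} (hlam : lam ∈ orthant m)
    (t : ℕ) :
    -∑ i, inner ℝ (pushSumEstimate W mu t i - lam) (Γ.g i (x t i))
      ≤ N / (2 * γ t) * (‖playerMean mu t - lam‖ ^ 2 - ‖playerMean mu (t + 1) - lam‖ ^ 2)
        + N ^ 2 * ‖lam‖ ^ 2 / 4 * β t
        + (N * ((N + 1) * M) ^ 2 / η + N * ((N + 1) * M) ^ 2 / 2) * γ t
        + (N + 1) * M * ∑ i, ‖pushSumEstimate W mu t i - playerMean mu t‖ := by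
  have hN' : (0 : ℝ) < N := by exact_mod_cast hN
  set K : ℝ := (N + 1) * M with hK
  have hγ := hs.γ_pos t
  have hβ := hs.β_pos t
  set hat : Fin N → Euc m := fun i => ∑ j, W t i j • mu t j with hhat
  set nu : Fin N → Euc m := fun i => pushSumEstimate W mu t i with hnu
  set bar := playerMean mu t with hbar
  set e : Fin N → Euc m := fun i => mu (t + 1) i - hat i with he
  have hmean : playerMean mu (t + 1) = bar + (1 / (N : ℝ)) • ∑ i, e i := by
    simp only [hbar, playerMean, he, hhat, Finset.sum_sub_distrib, hW.sum_mix, smul_sub]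
    abel
  have hen : ∀ i, ‖e i‖ ≤ γ t * K := h.norm_mu_increment_le hset hx0 hW hs hM hg t
  have hpl : ∀ i, inner ℝ (bar - lam) (e i) ≤ γ t * inner ℝ (nu i - lam) (Γ.g i (x t i))
      + γ t * (β t * (N * ‖lam‖ ^ 2 / 4)) + γ t ^ 2 * (K ^ 2 / η)
      + γ t * (K * ‖nu i - bar‖) := by
    intro i
    have hzi : 0 < pushWeight W (t + 1) i := hη.trans_le (hz _ _)
    set z := pushWeight W (t + 1) i with hzdef
    have hhatnu : hat i = z • nu i := by
      simp only [hnu, pushSumEstimate, hhat, ← hzdef]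
      rw [smul_smul, mul_inv_cancel₀ hzi.ne', one_smul]
    have h1 := inner_posPartVec_increment_le (a := hat i)
      (h := γ t • (Γ.g i (x t i) - β t • hat i)) (l := lam) (z := z)
      (h.mix_mu_nonneg hW t i) hzi hlam
    have he1 : e i = posPartVec (hat i + γ t • (Γ.g i (x t i) - β t • hat i)) - hat i := by
      simp only [he, h.mu_succ, hhat]
    have hnu1 : z⁻¹ • hat i = nu i := rfl
    rw [← he1, hnu1, norm_smul, Real.norm_of_nonneg hγ.le, inner_smul_right,
      inner_sub_right _ (Γ.g i (x t i)), inner_smul_right] at h1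
    have h2 : (γ t * ‖Γ.g i (x t i) - β t • hat i‖) ^ 2 / z ≤ γ t ^ 2 * (K ^ 2 / η) := by
      rw [mul_pow, mul_div_assoc]
      gcongr
      · exact h.norm_constraint_residual_le hset hx0 hW hs hM hg t i
      · exact hz _ _
    -- The cost of the regularization, by completing the square in ‖ν_i‖; the push-sum weight is at
    -- most N.
    have h3 : -inner ℝ (nu i - lam) (hat i) ≤ N * ‖lam‖ ^ 2 / 4 := by
      rw [hhatnu, inner_smul_right, inner_sub_left, real_inner_self_eq_norm_sq]
      have h4 := real_inner_le_norm lam (nu i)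
      have h5 : -(‖nu i‖ ^ 2 - inner ℝ lam (nu i)) ≤ ‖lam‖ ^ 2 / 4 := by
        nlinarith [sq_nonneg (‖nu i‖ - ‖lam‖ / 2)]
      calc -(z * (‖nu i‖ ^ 2 - inner ℝ lam (nu i)))
          = z * -(‖nu i‖ ^ 2 - inner ℝ lam (nu i)) := by ring
        _ ≤ z * (‖lam‖ ^ 2 / 4) := mul_le_mul_of_nonneg_left h5 hzi.le
        _ ≤ N * (‖lam‖ ^ 2 / 4) :=
          mul_le_mul_of_nonneg_right (hW.pushWeight_le _ _) (by positivity)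
        _ = _ := by ring
    -- The potential involves the mean multiplier, while the increment is controlled against the
    -- local estimate; the difference is a consensus error.
    have h6 : inner ℝ (bar - lam) (e i) = inner ℝ (nu i - lam) (e i) + inner ℝ (bar - nu i) (e i) := by
      rw [← inner_add_left]; congr 1; abel
    have h7 : inner ℝ (bar - nu i) (e i) ≤ γ t * (K * ‖nu i - bar‖) := by
      refine (real_inner_le_norm _ _).trans ?_
      rw [norm_sub_rev]
      calc ‖nu i - bar‖ * ‖e i‖ ≤ ‖nu i - bar‖ * (γ t * K) := by gcongr; exact hen i
        _ = _ := by ring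
    have h8 := mul_le_mul_of_nonneg_left h3 (mul_pos hγ hβ).le
    nlinarith
  have hsum : inner ℝ (bar - lam) (∑ i, e i)
      ≤ γ t * ∑ i, inner ℝ (nu i - lam) (Γ.g i (x t i))
        + N * (γ t * (β t * (N * ‖lam‖ ^ 2 / 4))) + N * (γ t ^ 2 * (K ^ 2 / η))
        + γ t * (K * ∑ i, ‖nu i - bar‖) := by
    rw [inner_sum]
    refine (Finset.sum_le_sum fun i _ => hpl i).trans (le_of_eq ?_)
    simp only [Finset.sum_add_distrib, Finset.mul_sum, Finset.sum_const, Finset.card_univ,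
      Fintype.card_fin, nsmul_eq_mul]
  have hesum : ‖(1 / (N : ℝ)) • ∑ i, e i‖ ^ 2 ≤ γ t ^ 2 * K ^ 2 := by
    rw [← mul_pow]
    gcongr
    rw [norm_smul, norm_div, norm_one, RCLike.norm_natCast]
    calc 1 / (N : ℝ) * ‖∑ i, e i‖ ≤ 1 / (N : ℝ) * ∑ i : Fin N, γ t * K := by
          gcongr
          exact (norm_sum_le _ _).trans (Finset.sum_le_sum fun i _ => hen i)
      _ = γ t * K := by
          simp only [Finset.sum_const, Finset.card_univ, Fintype.card_fin, nsmul_eq_mul]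
          field_simp
  have hexp : ‖playerMean mu (t + 1) - lam‖ ^ 2
      = ‖bar - lam‖ ^ 2 + 2 * (1 / (N : ℝ) * inner ℝ (bar - lam) (∑ i, e i))
        + ‖(1 / (N : ℝ)) • ∑ i, e i‖ ^ 2 := by
    rw [hmean, add_sub_right_comm, norm_add_sq_real, inner_smul_right]
  have hfin : ‖playerMean mu (t + 1) - lam‖ ^ 2 - ‖bar - lam‖ ^ 2
      ≤ 2 * (1 / (N : ℝ) * (γ t * ∑ i, inner ℝ (nu i - lam) (Γ.g i (x t i))
        + N * (γ t * (β t * (N * ‖lam‖ ^ 2 / 4))) + N * (γ t ^ 2 * (K ^ 2 / η))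
        + γ t * (K * ∑ i, ‖nu i - bar‖))) + γ t ^ 2 * K ^ 2 := by
    have := mul_le_mul_of_nonneg_left hsum (show 0 ≤ 1 / (N : ℝ) by positivity)
    linarith
  have hfin2 := mul_le_mul_of_nonneg_left hfin (show 0 ≤ N / (2 * γ t) by positivity)
  have e1 : N / (2 * γ t) * (2 * (1 / (N : ℝ) * (γ t * ∑ i, inner ℝ (nu i - lam) (Γ.g i (x t i))
        + N * (γ t * (β t * (N * ‖lam‖ ^ 2 / 4))) + N * (γ t ^ 2 * (K ^ 2 / η))
        + γ t * (K * ∑ i, ‖nu i - bar‖))) + γ t ^ 2 * K ^ 2)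
      = ∑ i, inner ℝ (nu i - lam) (Γ.g i (x t i)) + N ^ 2 * ‖lam‖ ^ 2 / 4 * β t
        + (N * K ^ 2 / η + N * K ^ 2 / 2) * γ t + K * ∑ i, ‖nu i - bar‖ := by
    field_simp; ring
  rw [e1] at hfin2
  linarith

/-- The progress of one primal step. -/
theorem primal_step (h : Γ.IsTrajectory W α β γ x0 Q x mu sigma)
    (hset : Γ.SetAssumption) (hx0 : ∀ i, x0 i ∈ Γ.X i) (hW : GraphAssumption W)
    (hs : StepSizes α β γ) {M : ℝ} (hg : ∀ i, ∀ x ∈ Γ.X i, ‖Γ.g i x‖ ≤ M)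
    {K D Lf : ℝ} (hLf : 0 ≤ Lf)
    (hlip : ∀ i, ∀ x ∈ Γ.X i, ∀ y y', ‖Γ.p i x y - Γ.p i x y'‖ ≤ Lf * ‖y - y'‖)
    (hD : ∀ i, ∀ x ∈ Γ.X i, ∀ y ∈ Γ.X i, ‖x - y‖ ≤ D)
    {κ : ℝ} (hmono : Γ.StronglyMonotone κ) {xstar : ∀ i, Euc (d i)}
    (hmem : ∀ i, xstar i ∈ Γ.X i) (hfeas : ∀ j, Γ.gsum xstar j ≤ 0) {lam : Euc m}
    (hlam : lam ∈ orthant m)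
    (hkkt : ∀ i, ∃ v ∈ normalCone (Γ.X i) (xstar i),
      Γ.p i (xstar i) (Γ.agg xstar) + gradMap (Γ.g i) (xstar i) lam + v = 0)
    (hcompl : ∃ v ∈ normalCone (orthant m) lam, -Γ.gsum xstar + v = 0) (t : ℕ)
    (hK : ∀ i, ‖Q t i + gradMap (Γ.g i) (x t i) (pushSumEstimate W mu t i)‖ ≤ K / β t) :
    κ * ‖WithLp.toLp 2 (x t) - WithLp.toLp 2 xstar‖ ^ 2
      ≤ 1 / (2 * α t) * (∑ i, ‖x t i - xstar i‖ ^ 2 - ∑ i, ‖x (t + 1) i - xstar i‖ ^ 2)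
        + N * K ^ 2 / 2 * (α t / β t ^ 2)
        + ∑ i, inner ℝ (Q t i - Γ.p i (x t i) (pushSumEstimate W sigma t i)) (xstar i - x t i)
        + Lf * D * ∑ i, ‖pushSumEstimate W sigma t i - playerMean sigma t‖
        + M * ∑ i, ‖pushSumEstimate W mu t i - playerMean mu t‖
        - ∑ i, inner ℝ (pushSumEstimate W mu t i - lam) (Γ.g i (x t i)) := by
  have hα := hs.α_pos t
  have hβ := hs.β_pos t
  have hx := h.x_mem hset hx0 t
  set nu : Fin N → Euc m := fun i => pushSumEstimate W mu t i with hnu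
  set sh : Fin N → Euc n := fun i => pushSumEstimate W sigma t i with hsh
  set bar := playerMean mu t with hbar
  set sbar := playerMean sigma t with hsbar
  have hagg : Γ.agg (x t) = sbar := (h.mean_sigma hW t).symm
  have hone : ∀ i, 2 * α t * inner ℝ (Q t i + gradMap (Γ.g i) (x t i) (nu i)) (x t i - xstar i)
      ≤ ‖x t i - xstar i‖ ^ 2 - ‖x (t + 1) i - xstar i‖ ^ 2 + α t ^ 2 * (K / β t) ^ 2 := by
    intro i
    have h1 := norm_proj_sub_le (hset.compact i) (hset.convex i)
      (x t i - α t • (Q t i + gradMap (Γ.g i) (x t i) (nu i))) (hmem i)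
    rw [← h.x_succ] at h1
    have h2 := norm_sub_smul_sq_le (a := x t i - xstar i) (α := α t) (hK i)
    rw [sub_right_comm] at h1
    have h3 : ‖x (t + 1) i - xstar i‖ ^ 2
      ≤ ‖x t i - xstar i - α t • (Q t i + gradMap (Γ.g i) (x t i) (nu i))‖ ^ 2 := by gcongr
    linarith
  -- The gradient inequality for g_i is used at x* with λ and at x_t with ν_i. Against g_i(x*), ν_i
  -- is exchanged for the common mean, since only the sum g(x*) has a sign.
  have hlow : ∀ i, inner ℝ (Γ.p i (x t i) sbar - Γ.p i (xstar i) (Γ.agg xstar)) (x t i - xstar i)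
      + inner ℝ (nu i - lam) (Γ.g i (x t i)) + inner ℝ lam (Γ.g i (xstar i))
      - inner ℝ bar (Γ.g i (xstar i))
      - inner ℝ (Q t i - Γ.p i (x t i) (sh i)) (xstar i - x t i)
      - Lf * D * ‖sh i - sbar‖ - M * ‖nu i - bar‖
      ≤ inner ℝ (Q t i + gradMap (Γ.g i) (x t i) (nu i)) (x t i - xstar i) := by
    intro i
    obtain ⟨v, hv, hv0⟩ := hkkt i
    have h1 : inner ℝ v (x t i - xstar i) ≤ 0 := hv _ (hx i)
    have h2 : inner ℝ (Γ.p i (xstar i) (Γ.agg xstar)) (x t i - xstar i)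
        + inner ℝ lam (fderiv ℝ (Γ.g i) (xstar i) (x t i - xstar i))
        + inner ℝ v (x t i - xstar i) = 0 := by
      rw [← inner_gradMap, ← inner_add_left, ← inner_add_left, hv0, inner_zero_left]
    have h3 : inner ℝ lam (fderiv ℝ (Γ.g i) (xstar i) (x t i - xstar i))
        ≤ inner ℝ lam (Γ.g i (x t i) - Γ.g i (xstar i)) :=
      inner_le_inner_of_nonneg hlam fun j =>
        fderiv_apply_le_of_convexOn (hset.g_convex i j) (hmem i) (hx i) (hset.g_diff i _ (hmem i))
    have h4 : inner ℝ (nu i) (fderiv ℝ (Γ.g i) (x t i) (xstar i - x t i))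
        ≤ inner ℝ (nu i) (Γ.g i (xstar i) - Γ.g i (x t i)) :=
      inner_le_inner_of_nonneg (h.estimate_mu_nonneg hW t i) fun j =>
        fderiv_apply_le_of_convexOn (hset.g_convex i j) (hx i) (hmem i) (hset.g_diff i _ (hx i))
    rw [← neg_sub (x t i) (xstar i), map_neg, inner_neg_right, ← inner_gradMap] at h4
    have h5 : -(Lf * D * ‖sh i - sbar‖)
        ≤ inner ℝ (Γ.p i (x t i) (sh i) - Γ.p i (x t i) sbar) (x t i - xstar i) := by
      have h6 := (abs_le.1 (abs_real_inner_le_norm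
        (Γ.p i (x t i) (sh i) - Γ.p i (x t i) sbar) (x t i - xstar i))).1
      have h7 : ‖Γ.p i (x t i) (sh i) - Γ.p i (x t i) sbar‖ * ‖x t i - xstar i‖
          ≤ (Lf * ‖sh i - sbar‖) * D :=
        mul_le_mul (hlip i _ (hx i) _ _) (hD i _ (hx i) _ (hmem i)) (norm_nonneg _)
          (by positivity)
      linarith
    have h8 : inner ℝ (nu i - bar) (Γ.g i (xstar i)) ≤ M * ‖nu i - bar‖ := by
      refine (real_inner_le_norm _ _).trans ?_
      rw [mul_comm]
      exact mul_le_mul_of_nonneg_right (hg i _ (hmem i)) (norm_nonneg _)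
    rw [← neg_sub (x t i) (xstar i), inner_neg_right]
    simp only [inner_sub_left, inner_add_left, inner_sub_right] at *
    linarith
  -- Testing the normal cone at the origin gives the half of complementary slackness that is needed.
  have hcs : 0 ≤ inner ℝ lam (Γ.gsum xstar) := by
    obtain ⟨v, hv, hv0⟩ := hcompl
    have hveq : v = Γ.gsum xstar := by rwa [neg_add_eq_zero, eq_comm] at hv0
    have := hv 0 (fun j => by simp)
    rw [zero_sub, inner_neg_right, hveq, real_inner_comm] at this
    linarith
  have hfe : inner ℝ bar (Γ.gsum xstar) ≤ 0 := by
    have := inner_le_inner_of_nonneg (u := bar) (v := Γ.gsum xstar) (w := 0)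
      (h.mean_mu_nonneg t) (by simpa using hfeas)
    rwa [inner_zero_right] at this
  have hm := hmono (x t) xstar hx hmem
  rw [PiLp.inner_apply] at hm
  simp only [pseudoGradient, PiLp.sub_apply, hagg] at hm
  have htot := Finset.sum_le_sum fun i (_ : i ∈ Finset.univ) => hlow i
  simp only [Finset.sum_add_distrib, Finset.sum_sub_distrib, ← Finset.mul_sum, ← inner_sum] at htot
  rw [← gsum] at htot
  have hone' := Finset.sum_le_sum fun i (_ : i ∈ Finset.univ) => hone i
  simp only [Finset.sum_add_distrib, Finset.sum_sub_distrib, ← Finset.mul_sum, Finset.sum_const,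
    Finset.card_univ, Fintype.card_fin, nsmul_eq_mul] at hone'
  have hfin := mul_le_mul_of_nonneg_left hone' (show 0 ≤ 1 / (2 * α t) by positivity)
  have e1 : ∀ A : ℝ, 1 / (2 * α t) * (2 * α t * A) = A := fun A => by field_simp
  have e2 : 1 / (2 * α t) * (α t ^ 2 * (N * (K / β t) ^ 2)) = N * K ^ 2 / 2 * (α t / β t ^ 2) := by
    field_simp
  rw [e1, mul_add, e2] at hfin
  linarith

end IsTrajectory

end AggGame

/-! ### The pathwise regret bound -/

theorem add_mul_le_sum_mul_sum {k₁ k₂ k₃ k₄ k₅ u₁ u₂ u₃ u₄ u₅ : ℝ} (hk₁ : 0 ≤ k₁) (hk₂ : 0 ≤ k₂)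
    (hk₃ : 0 ≤ k₃) (hk₄ : 0 ≤ k₄) (hk₅ : 0 ≤ k₅) (hu₁ : 0 ≤ u₁) (hu₂ : 0 ≤ u₂) (hu₃ : 0 ≤ u₃)
    (hu₄ : 0 ≤ u₄) (hu₅ : 0 ≤ u₅) :
    k₁ * u₁ + k₂ * u₂ + k₃ * u₃ + k₄ * u₄ + k₅ * u₅
      ≤ (k₁ + k₂ + k₃ + k₄ + k₅ + 1) * (u₁ + u₂ + u₃ + u₄ + u₅) := by
  have h : ∀ k u : ℝ, 0 ≤ u → k ≤ k₁ + k₂ + k₃ + k₄ + k₅ + 1 →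
      k * u ≤ (k₁ + k₂ + k₃ + k₄ + k₅ + 1) * u := fun k u hu hk => by gcongr
  have h1 := h k₁ u₁ hu₁ (by linarith)
  have h2 := h k₂ u₂ hu₂ (by linarith)
  have h3 := h k₃ u₃ hu₃ (by linarith)
  have h4 := h k₄ u₄ hu₄ (by linarith)
  have h5 := h k₅ u₅ hu₅ (by linarith)
  linarith

namespace AggGame

variable {N n m : ℕ} {d r : Fin N → ℕ}

/-- The pathwise regret bound. -/
theorem exists_regret_bound (Γ : AggGame N n m d r) {W : ℕ → Matrix (Fin N) (Fin N) ℝ}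
    {α β γ : ℕ → ℝ} (hN : 0 < N) (hset : Γ.SetAssumption) (hW : GraphAssumption W)
    (hs : StepSizes α β γ) (hlip : Γ.GradLipschitz) {κ : ℝ} (hmono : Γ.StronglyMonotone κ)
    {x0 xstar : ∀ i, Euc (d i)} (hx0 : ∀ i, x0 i ∈ Γ.X i) (hxstar : Γ.IsVGNE xstar)
    {S : ℝ} (hS : 0 ≤ S) :
    ∃ C > 0, ∀ Q x mu sigma, Γ.IsTrajectory W α β γ x0 Q x mu sigma → (∀ t i, ‖Q t i‖ ≤ S) → ∀ T,
      κ * ∑ t ∈ Finset.range (T + 1), ‖WithLp.toLp 2 (x t) - WithLp.toLp 2 xstar‖ ^ 2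
        ≤ ∑ t ∈ Finset.range (T + 1), ∑ i,
            inner ℝ (Q t i - Γ.p i (x t i) (pushSumEstimate W sigma t i)) (xstar i - x t i)
          + C * (1 / α T + 1 / (β T ^ 2 * γ T) + ∑ t ∈ Finset.range (T + 1), α t / β t ^ 2
            + ∑ t ∈ Finset.range (T + 1), β t + ∑ t ∈ Finset.range (T + 1), γ t) := by
  obtain ⟨D, hD0, hD⟩ := hset.exists_diam
  obtain ⟨M, hM0, hM⟩ := hset.exists_norm_g_le
  obtain ⟨M', hM'⟩ := hset.g_grad_bdd
  obtain ⟨Lσ, hLσ, hψ⟩ := hset.ψ_lip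
  obtain ⟨Lf, hLf, hp⟩ := hlip
  obtain ⟨η, hη, hz⟩ := hW.exists_le_pushWeight
  obtain ⟨B₁, hB₁, htrack⟩ := hW.exists_sum_pushSum_error_le (E := Euc n) hN
  obtain ⟨B₂, hB₂, hcons⟩ := hW.exists_sum_pushSum_error_le (E := Euc m) hN
  obtain ⟨⟨hmem, hfeas, -⟩, lam, hlam, hkkt, hcompl⟩ := hxstar
  have hM'0 : 0 ≤ M' := (norm_nonneg _).trans (hM' ⟨0, hN⟩ _ (hx0 _))
  set K : ℝ := S + M' * (η⁻¹ * (N * M)) with hK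
  have hK0 : 0 ≤ K := by positivity
  set c₀ : ℝ := ∑ i, ‖Γ.ψ i (x0 i)‖ with hc₀
  have hc₀0 : 0 ≤ c₀ := Finset.sum_nonneg fun i _ => norm_nonneg _
  -- The five groups are the coefficients of the five terms in the bound, in that order; the final 1
  -- makes the constant positive.
  refine ⟨N * D ^ 2 / 2 + (Lf * D * B₁ * c₀ + (M + ‖lam‖) ^ 2 * N / 2)
    + (N * K ^ 2 / 2 + Lf * D * B₁ * (2 * (N * (Lσ * K)))) + N ^ 2 * ‖lam‖ ^ 2 / 4
    + ((N * ((N + 1) * M) ^ 2 / η + N * ((N + 1) * M) ^ 2 / 2)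
      + (M + (N + 1) * M) * B₂ * (2 * (N * ((N + 1) * M)))) + 1, by positivity,
    fun Q x mu sigma h hQ T => ?_⟩
  have hx := h.x_mem hset hx0
  have hdir := fun t i =>
    h.norm_direction_le hset hx0 hW hs hM0 hM hη hz hM'0 hM' hS t i (hQ t i)
  set a : ℕ → ℝ := fun t => ∑ i, ‖x t i - xstar i‖ ^ 2 with ha
  set b : ℕ → ℝ := fun t => ‖playerMean mu t - lam‖ ^ 2 with hb
  set eσ : ℕ → ℝ := fun t => ∑ i, ‖pushSumEstimate W sigma t i - playerMean sigma t‖ with heσ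
  set eμ : ℕ → ℝ := fun t => ∑ i, ‖pushSumEstimate W mu t i - playerMean mu t‖ with heμ
  set noise : ℕ → ℝ := fun t => ∑ i,
    inner ℝ (Q t i - Γ.p i (x t i) (pushSumEstimate W sigma t i)) (xstar i - x t i) with hnoise
  set SA := ∑ t ∈ Finset.range (T + 1), α t / β t ^ 2 with hSA
  set SB := ∑ t ∈ Finset.range (T + 1), β t with hSB
  set SG := ∑ t ∈ Finset.range (T + 1), γ t with hSG
  have hstep : ∀ t, κ * ‖WithLp.toLp 2 (x t) - WithLp.toLp 2 xstar‖ ^ 2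
      ≤ 1 / (2 * α t) * (a t - a (t + 1)) + N / (2 * γ t) * (b t - b (t + 1))
        + N * K ^ 2 / 2 * (α t / β t ^ 2) + noise t + Lf * D * eσ t + (M + (N + 1) * M) * eμ t
        + N ^ 2 * ‖lam‖ ^ 2 / 4 * β t
        + (N * ((N + 1) * M) ^ 2 / η + N * ((N + 1) * M) ^ 2 / 2) * γ t := by
    intro t
    have h1 := h.primal_step hset hx0 hW hs hM hLf.le hp hD hmono hmem hfeas hlam hkkt hcompl t
      (hdir t)
    have h2 := h.dual_step hN hset hx0 hW hs hM0 hM hη hz hlam t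
    linarith
  have hsum := Finset.sum_le_sum fun t (_ : t ∈ Finset.range (T + 1)) => hstep t
  simp only [Finset.sum_add_distrib, ← Finset.mul_sum] at hsum
  rw [← hSA, ← hSB, ← hSG] at hsum
  have hprim : ∑ t ∈ Finset.range (T + 1), 1 / (2 * α t) * (a t - a (t + 1))
      ≤ N * D ^ 2 * (1 / (2 * α T)) := by
    refine sum_mul_sub_le (c := fun t => 1 / (2 * α t)) (A := fun _ => N * D ^ 2)
      (fun s t hst => ?_) (by have := hs.α_pos 0; positivity)
      (fun t => Finset.sum_nonneg fun i _ => by positivity) monotone_const (fun t => ?_) T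
    · have := hs.α_pos t
      exact one_div_le_one_div_of_le (by positivity) (by linarith [hs.α_anti hst])
    · have : ∀ i ∈ Finset.univ, ‖x t i - xstar i‖ ^ 2 ≤ D ^ 2 := fun i _ =>
        pow_le_pow_left₀ (norm_nonneg _) (hD i _ (hx t i) _ (hmem i)) 2
      exact (Finset.sum_le_sum this).trans (by simp)
  -- The distance of the mean multiplier to λ is only bounded by a multiple of 1/β_T, whence 1/(β_T²
  -- γ_T).
  have hdual : ∑ t ∈ Finset.range (T + 1), N / (2 * γ t) * (b t - b (t + 1))
      ≤ ((M + ‖lam‖) / β T) ^ 2 * (N / (2 * γ T)) := by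
    refine sum_mul_sub_le (c := fun t => N / (2 * γ t)) (A := fun t => ((M + ‖lam‖) / β t) ^ 2)
      (fun s t hst => ?_) (by have := hs.γ_pos 0; positivity)
      (fun t => by positivity) (fun s t hst => ?_) (fun t => ?_) T
    · have := hs.γ_pos t
      exact div_le_div_of_nonneg_left (by positivity) (by positivity)
        (by linarith [hs.γ_anti hst])
    · have := hs.β_pos t
      have := hs.β_pos s
      have := hs.β_anti hst
      dsimp only
      gcongr
    · have hβ := hs.β_pos t
      have hN' : (0 : ℝ) < N := by exact_mod_cast hN
      refine pow_le_pow_left₀ (norm_nonneg _) ((norm_sub_le _ _).trans ?_) 2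
      rw [add_div]
      refine add_le_add ?_ (le_div_self (norm_nonneg _) hβ (hs.β_le_one t))
      rw [playerMean, norm_smul, norm_div, norm_one, RCLike.norm_natCast]
      calc 1 / (N : ℝ) * ‖∑ j, mu t j‖ ≤ 1 / (N : ℝ) * (N * M / β t) := by
            gcongr
            exact (norm_sum_le _ _).trans (h.sum_norm_mu_le hset hx0 hW hs hM0 hM t)
        _ = M / β t := by field_simp
  -- Trackers are perturbed by at most a multiple of α_t/β_t, the length of a primal step, and
  -- α_t/β_t ≤ α_t/β_t² since β_t ≤ 1.
  have hσ : ∑ t ∈ Finset.range (T + 1), eσ t ≤ B₁ * (c₀ + 2 * (N * (Lσ * K)) * SA) := by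
    have hb0 : ∀ t, 0 ≤ N * (Lσ * K) * (α t / β t) := fun t => by
      have := hs.α_pos t
      have := hs.β_pos t
      positivity
    have h1 := htrack sigma (fun t => N * (Lσ * K) * (α t / β t))
      (fun s t hst => mul_le_mul_of_nonneg_left (hs.αβ_anti hst) (by positivity))
      (fun t => ?_) (T + 1)
    · have e : ∑ i, ‖sigma 0 i‖ = c₀ := by simp only [h.sigma_zero, hc₀]
      rw [e] at h1
      refine h1.trans (mul_le_mul_of_nonneg_left ?_ hB₁.le)
      have h2 : N * (Lσ * K) * (α 0 / β 0)
          ≤ ∑ t ∈ Finset.range (T + 1), N * (Lσ * K) * (α t / β t) :=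
        Finset.single_le_sum (f := fun t => N * (Lσ * K) * (α t / β t)) (fun t _ => hb0 t)
          (Finset.mem_range.2 (Nat.succ_pos T))
      have h3 : ∑ t ∈ Finset.range (T + 1), N * (Lσ * K) * (α t / β t) ≤ N * (Lσ * K) * SA := by
        rw [← Finset.mul_sum]
        refine mul_le_mul_of_nonneg_left (Finset.sum_le_sum fun t _ => ?_) (by positivity)
        have := hs.β_pos t
        refine div_le_div_of_nonneg_left (hs.α_pos t).le (by positivity) ?_
        nlinarith [hs.β_le_one t]
      linarith
    · have h4 : ∀ i ∈ Finset.univ, ‖sigma (t + 1) i - ∑ j, W t i j • sigma t j‖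
          ≤ Lσ * (K * (α t / β t)) := by
        intro i _
        rw [h.sigma_succ, add_sub_assoc, add_sub_cancel_left]
        refine (hψ i _ (hx _ i) _ (hx _ i)).trans (mul_le_mul_of_nonneg_left ?_ hLσ.le)
        have h5 := norm_proj_sub_le (hset.compact i) (hset.convex i)
          (x t i - α t • (Q t i + gradMap (Γ.g i) (x t i) (pushSumEstimate W mu t i))) (hx t i)
        rw [← h.x_succ, sub_sub_cancel_left, norm_neg, norm_smul,
          Real.norm_of_nonneg (hs.α_pos t).le] at h5
        refine h5.trans ((mul_le_mul_of_nonneg_left (hdir t i) (hs.α_pos t).le).trans (le_of_eq ?_))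
        ring
      refine (Finset.sum_le_sum h4).trans (le_of_eq ?_)
      simp only [Finset.sum_const, Finset.card_univ, Fintype.card_fin, nsmul_eq_mul]
      ring
  have hμ : ∑ t ∈ Finset.range (T + 1), eμ t ≤ B₂ * (2 * (N * ((N + 1) * M)) * SG) := by
    have h1 := hcons mu (fun t => N * ((N + 1) * M) * γ t)
      (fun _ _ hst => mul_le_mul_of_nonneg_left (hs.γ_anti hst) (by positivity))
      (fun t => ?_) (T + 1)
    · have e : ∑ i, ‖mu 0 i‖ = 0 := by simp [h.mu_zero]
      rw [e] at h1
      refine h1.trans (mul_le_mul_of_nonneg_left ?_ hB₂.le)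
      have h2 : N * ((N + 1) * M) * γ 0 ≤ ∑ t ∈ Finset.range (T + 1), N * ((N + 1) * M) * γ t :=
        Finset.single_le_sum (f := fun t => N * ((N + 1) * M) * γ t)
          (fun t _ => by have := hs.γ_pos t; positivity) (Finset.mem_range.2 (Nat.succ_pos T))
      rw [← Finset.mul_sum] at h2 ⊢
      linarith
    · refine (Finset.sum_le_sum fun i _ =>
        h.norm_mu_increment_le hset hx0 hW hs hM0 hM t i).trans (le_of_eq ?_)
      simp only [Finset.sum_const, Finset.card_univ, Fintype.card_fin, nsmul_eq_mul]
      ring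
  have hαT := hs.α_pos T
  have hβT := hs.β_pos T
  have hγT := hs.γ_pos T
  -- Lets this term absorb the constant contribution of the initial trackers.
  have hv : 1 ≤ 1 / (β T ^ 2 * γ T) := by
    rw [le_div_iff₀ (by positivity), one_mul]
    exact mul_le_one₀ (pow_le_one₀ hβT.le (hs.β_le_one T)) hγT.le (hs.γ_le_one T)
  have hSA0 : 0 ≤ SA := Finset.sum_nonneg fun t _ => by
    have := hs.α_pos t
    positivity
  have hSB0 : 0 ≤ SB := Finset.sum_nonneg fun t _ => (hs.β_pos t).le
  have hSG0 : 0 ≤ SG := Finset.sum_nonneg fun t _ => (hs.γ_pos t).le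
  have hcomb := add_mul_le_sum_mul_sum (k₁ := N * D ^ 2 / 2)
    (k₂ := Lf * D * B₁ * c₀ + (M + ‖lam‖) ^ 2 * N / 2)
    (k₃ := N * K ^ 2 / 2 + Lf * D * B₁ * (2 * (N * (Lσ * K)))) (k₄ := N ^ 2 * ‖lam‖ ^ 2 / 4)
    (k₅ := (N * ((N + 1) * M) ^ 2 / η + N * ((N + 1) * M) ^ 2 / 2)
      + (M + (N + 1) * M) * B₂ * (2 * (N * ((N + 1) * M))))
    (u₁ := 1 / α T) (u₂ := 1 / (β T ^ 2 * γ T)) (by positivity) (by positivity) (by positivity)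
    (by positivity) (by positivity) (by positivity) (by positivity) hSA0 hSB0 hSG0
  have e1 : (N : ℝ) * D ^ 2 * (1 / (2 * α T)) = N * D ^ 2 / 2 * (1 / α T) := by field_simp
  have e2 : ((M + ‖lam‖) / β T) ^ 2 * (N / (2 * γ T))
      = (M + ‖lam‖) ^ 2 * N / 2 * (1 / (β T ^ 2 * γ T)) := by field_simp
  have h1 := mul_le_mul_of_nonneg_left hσ (show 0 ≤ Lf * D by positivity)
  have h2 := mul_le_mul_of_nonneg_left hμ (show 0 ≤ M + (N + 1) * M by positivity)
  have h3 := mul_le_mul_of_nonneg_left hv (show 0 ≤ Lf * D * B₁ * c₀ by positivity)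
  rw [e1] at hprim
  rw [e2] at hdual
  linarith

theorem run_z (Γ : AggGame N n m d r) (W : ℕ → Matrix (Fin N) (Fin N) ℝ) (α β γ : ℕ → ℝ)
    (x0 : ∀ i, Euc (d i)) (ξ : ℕ → ∀ i, Euc (r i)) (t : ℕ) :
    (Γ.run W α β γ x0 ξ t).z = pushWeight W t := by
  induction t with
  | zero => rfl
  | succ t ih => simp only [run, step, ih, pushWeight]

/-- The push-sum weights do not depend on the samples, so the algorithm fits the deterministic
description for each sample path. -/
theorem isTrajectory_run (Γ : AggGame N n m d r) (W : ℕ → Matrix (Fin N) (Fin N) ℝ)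
    (α β γ : ℕ → ℝ) (x0 : ∀ i, Euc (d i)) (ξ : ℕ → ∀ i, Euc (r i)) :
    Γ.IsTrajectory W α β γ x0
      (fun t i => Γ.q i t ((Γ.run W α β γ x0 ξ t).x i)
        (pushSumEstimate W (fun t => (Γ.run W α β γ x0 ξ t).sigma) t i) (ξ t i))
      (fun t => (Γ.run W α β γ x0 ξ t).x) (fun t => (Γ.run W α β γ x0 ξ t).mu)
      (fun t => (Γ.run W α β γ x0 ξ t).sigma) where
  x_zero := rfl
  mu_zero _ := rfl
  sigma_zero _ := rfl
  x_succ t i := by simp only [run, step, run_z, pushSumEstimate, pushWeight]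
  mu_succ t i := by simp only [run, step]
  sigma_succ t i := by simp only [run, step]

end AggGame

/-! ### Rates for polynomial stepsizes -/

theorem stepSizes_polyStep {a1 a2 a3 : ℝ} (ha2 : 0 < 2 * a2) (ha12 : 2 * a2 < a1) (ha3 : 0 < a3) :
    StepSizes (polyStep a1) (polyStep a2) (polyStep a3) where
  α_pos := polyStep_pos a1
  β_pos := polyStep_pos a2
  γ_pos := polyStep_pos a3
  β_le_one := polyStep_le_one (by linarith)
  γ_le_one := polyStep_le_one ha3.le
  α_anti := antitone_polyStep (by linarith)
  β_anti := antitone_polyStep (by linarith)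
  γ_anti := antitone_polyStep ha3.le
  αβ_anti := by
    simp only [polyStep_div]
    exact antitone_polyStep (by linarith)

/-- The five terms are of order T^(1-e) with e running through 1 - a1, 1 - 2a2 - a3, a1 - 2a2, a2
and a3; `rateExp` is the smallest of these. -/
theorem exists_polyStep_rate {a1 a2 a3 : ℝ} (ha1' : a1 < 1) (ha3 : 0 < a3) (ha3' : a3 < 1)
    (ha2 : 0 < 2 * a2) (ha12 : 2 * a2 < a1) (ha23 : 2 * a2 + a3 < 1) :
    ∃ C > 0, ∀ T : ℕ, 1 ≤ T →
      1 / polyStep a1 T + 1 / (polyStep a2 T ^ 2 * polyStep a3 T)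
        + ∑ t ∈ Finset.range (T + 1), polyStep a1 t / polyStep a2 t ^ 2
        + ∑ t ∈ Finset.range (T + 1), polyStep a2 t + ∑ t ∈ Finset.range (T + 1), polyStep a3 t
      ≤ C * (T : ℝ) ^ (1 - rateExp a1 a2 a3) := by
  have h1 : 0 < 1 - (a1 - 2 * a2) := by linarith
  have h2 : 0 < 1 - a2 := by linarith
  have h3 : 0 < 1 - a3 := by linarith
  refine ⟨1 + 1 + 2 / (1 - (a1 - 2 * a2)) + 2 / (1 - a2) + 2 / (1 - a3), by positivity,
    fun T hT => ?_⟩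
  have hT0 : (0 : ℝ) < T := by exact_mod_cast hT
  have hT1 : (1 : ℝ) ≤ T := by exact_mod_cast hT
  have r1 : rateExp a1 a2 a3 ≤ 1 - a1 := min_le_left _ _
  have r2 : rateExp a1 a2 a3 ≤ 1 - 2 * a2 - a3 := (min_le_right _ _).trans (min_le_left _ _)
  have r3 : rateExp a1 a2 a3 ≤ a3 :=
    (min_le_right _ _).trans ((min_le_right _ _).trans (min_le_left _ _))
  have r4 : rateExp a1 a2 a3 ≤ a2 := (min_le_right _ _).trans
    ((min_le_right _ _).trans ((min_le_right _ _).trans (min_le_left _ _)))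
  have r5 : rateExp a1 a2 a3 ≤ a1 - 2 * a2 := (min_le_right _ _).trans
    ((min_le_right _ _).trans ((min_le_right _ _).trans (min_le_right _ _)))
  have hpow : ∀ e : ℝ, e ≤ 1 - rateExp a1 a2 a3 → (T : ℝ) ^ e ≤ (T : ℝ) ^ (1 - rateExp a1 a2 a3) :=
    fun e he => Real.rpow_le_rpow_of_exponent_le hT1 he
  have hsum : ∀ a : ℝ, 0 < a → a < 1 → rateExp a1 a2 a3 ≤ a →
      ∑ t ∈ Finset.range (T + 1), polyStep a t
        ≤ 2 / (1 - a) * (T : ℝ) ^ (1 - rateExp a1 a2 a3) := by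
    intro a h0 h1 hr
    have : 0 < 1 - a := by linarith
    refine (sum_polyStep_le h0.le h1 hT).trans ?_
    gcongr
  have e1 : 1 / polyStep a1 T = (T : ℝ) ^ a1 := by
    rw [polyStep_of_pos a1 hT, Real.rpow_neg hT0.le, one_div, inv_inv]
  have e2 : 1 / (polyStep a2 T ^ 2 * polyStep a3 T) = (T : ℝ) ^ (2 * a2 + a3) := by
    rw [polyStep_of_pos a2 hT, polyStep_of_pos a3 hT, sq, ← Real.rpow_add hT0, ← Real.rpow_add hT0,
      one_div, ← Real.rpow_neg hT0.le]
    congr 1; ring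
  have e3 : ∀ t, polyStep a1 t / polyStep a2 t ^ 2 = polyStep (a1 - 2 * a2) t := by
    intro t
    rw [sq, ← div_div, polyStep_div, polyStep_div]
    congr 1; ring
  simp only [e1, e2, e3]
  have t1 := hpow a1 (by linarith)
  have t2 := hpow (2 * a2 + a3) (by linarith)
  have t3 := hsum (a1 - 2 * a2) (by linarith) (by linarith) r5
  have t4 := hsum a2 (by linarith) (by linarith) r4
  have t5 := hsum a3 ha3 ha3' r3
  linarith

/-! ### Adaptedness of the iterates and sampling noise -/

namespace AggGame

variable {N n m : ℕ} {d r : Fin N → ℕ}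

/-- The state variables are random variables. -/
structure IsMeasurableState {Ω : Type*} (mΩ : MeasurableSpace Ω) (s : Ω → AlgState N n m d) :
    Prop where
  z : ∀ i, Measurable fun ω => (s ω).z i
  x : ∀ i, Measurable fun ω => (s ω).x i
  mu : ∀ i, Measurable fun ω => (s ω).mu i
  sigma : ∀ i, Measurable fun ω => (s ω).sigma i

/-- The data of the game are controlled only on the decision sets, so measurability is passed
through the subtype. -/
theorem _root_.Measurable.comp_of_mem {Ω E F : Type*} {mΩ : MeasurableSpace Ω} [MeasurableSpace E]
    [MeasurableSpace F] {K : Set E} {h : E → F} (hh : Measurable fun x : K => h x) {x : Ω → E}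
    (hx : Measurable x) (hmem : ∀ ω, x ω ∈ K) : Measurable fun ω => h (x ω) :=
  hh.comp (hx.subtype_mk (h := hmem))

theorem _root_.Measurable.comp_of_mem₃ {Ω E F G H : Type*} {mΩ : MeasurableSpace Ω}
    [MeasurableSpace E] [MeasurableSpace F] [MeasurableSpace G] [MeasurableSpace H] {K : Set E}
    {h : E → F → G → H} (hh : Measurable fun z : K × F × G => h z.1 z.2.1 z.2.2) {x : Ω → E}
    {y : Ω → F} {ξ : Ω → G} (hx : Measurable x) (hmem : ∀ ω, x ω ∈ K) (hy : Measurable y)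
    (hξ : Measurable ξ) : Measurable fun ω => h (x ω) (y ω) (ξ ω) :=
  hh.comp ((hx.subtype_mk (h := hmem)).prodMk (hy.prodMk hξ))

theorem IsMeasurableState.step {Ω : Type*} {mΩ : MeasurableSpace Ω} {Γ : AggGame N n m d r}
    (hset : Γ.SetAssumption) {t : ℕ}
    (hq : ∀ i, Measurable (fun z : Γ.X i × Euc n × Euc (r i) => Γ.q i t z.1 z.2.1 z.2.2))
    {s : Ω → AlgState N n m d} (hs : IsMeasurableState mΩ s) (hmem : ∀ ω i, (s ω).x i ∈ Γ.X i)
    {ξ : Ω → ∀ i, Euc (r i)} (hξ : ∀ i, Measurable fun ω => ξ ω i)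
    (w : Matrix (Fin N) (Fin N) ℝ) (α β γ : ℝ) :
    IsMeasurableState mΩ fun ω => Γ.step w α β γ t (ξ ω) (s ω) := by
  have hz : ∀ i, Measurable fun ω => ∑ j, w i j * (s ω).z j := fun i =>
    Finset.measurable_sum _ fun j _ => (hs.z j).const_mul _
  have hmu : ∀ i, Measurable fun ω => ∑ j, w i j • (s ω).mu j := fun i =>
    Finset.measurable_sum _ fun j _ => (hs.mu j).const_smul (w i j)
  have hsig : ∀ i, Measurable fun ω => ∑ j, w i j • (s ω).sigma j := fun i =>
    Finset.measurable_sum _ fun j _ => (hs.sigma j).const_smul (w i j)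
  have hg : ∀ i, Measurable fun ω => Γ.g i ((s ω).x i) := fun i =>
    Measurable.comp_of_mem (h := Γ.g i) (hset.continuousOn_g i).domRestrict.measurable (hs.x i)
      fun ω => hmem ω i
  have hψ : ∀ i {x : Ω → Euc (d i)}, Measurable x → (∀ ω, x ω ∈ Γ.X i) →
      Measurable fun ω => Γ.ψ i (x ω) := fun i x hx hmem =>
    Measurable.comp_of_mem (h := Γ.ψ i) (hset.continuousOn_ψ i).domRestrict.measurable hx hmem
  have hgrad : ∀ i, Measurable fun ω => gradMap (Γ.g i) ((s ω).x i) := fun i =>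
    Measurable.comp_of_mem (h := gradMap (Γ.g i)) (hset.g_grad_meas i) (hs.x i) fun ω => hmem ω i
  have happly : ∀ i, Measurable fun ω => gradMap (Γ.g i) ((s ω).x i)
      ((∑ j, w i j * (s ω).z j)⁻¹ • ∑ j, w i j • (s ω).mu j) := fun i => by
    have hc : Continuous fun z : (Euc m →L[ℝ] Euc (d i)) × Euc m => z.1 z.2 := by fun_prop
    exact hc.measurable.comp ((hgrad i).prodMk ((hz i).inv.smul (hmu i)))
  have hx' : ∀ i, Measurable fun ω => (Γ.step w α β γ t (ξ ω) (s ω)).x i := fun i => by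
    refine (continuous_proj (hset.nonempty i) (hset.compact i)
      (hset.convex i)).measurable.comp ((hs.x i).sub (Measurable.const_smul (Measurable.add ?_ (happly i)) α))
    exact Measurable.comp_of_mem₃ (h := Γ.q i t) (hq i) (hs.x i) (fun ω => hmem ω i)
      ((hz i).inv.smul (hsig i)) (hξ i)
  refine ⟨hz, hx', fun i => ?_, fun i => ?_⟩
  · exact continuous_posPartVec.measurable.comp
      ((hmu i).add (Measurable.const_smul ((hg i).sub ((hmu i).const_smul β)) γ))
  · exact ((hsig i).add (hψ i (hx' i)
      fun ω => (proj_spec (hset.nonempty i) (hset.compact i) _).1)).sub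
      (hψ i (hs.x i) fun ω => hmem ω i)

theorem IsMeasurableState.mono {Ω : Type*} {m₁ m₂ : MeasurableSpace Ω} (hle : m₁ ≤ m₂)
    {s : Ω → AlgState N n m d} (hs : IsMeasurableState m₁ s) : IsMeasurableState m₂ s where
  z i := (hs.z i).mono hle le_rfl
  x i := (hs.x i).mono hle le_rfl
  mu i := (hs.mu i).mono hle le_rfl
  sigma i := (hs.sigma i).mono hle le_rfl

section History

variable {Ω : Type*} {ξ : ∀ i : Fin N, ℕ → Ω → Euc (r i)}

theorem history_mono : Monotone (history ξ) := fun _ _ h =>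
  iSup_mono fun _ => iSup_mono fun _ => iSup_mono' fun hs => ⟨hs.trans_le h, le_rfl⟩

theorem history_le [mΩ : MeasurableSpace Ω] (hξ : ∀ i t, Measurable (ξ i t)) (t : ℕ) :
    history ξ t ≤ mΩ :=
  iSup_le fun i => iSup_le fun s => iSup_le fun _ => (hξ i s).comap_le

theorem measurable_history {i : Fin N} {s t : ℕ} (h : s < t) : Measurable[history ξ t] (ξ i s) := by
  refine Measurable.mono (comap_measurable (ξ i s)) ?_ le_rfl
  exact le_iSup_of_le i (le_iSup_of_le s (le_iSup_of_le h le_rfl))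

/-- Adaptedness allows the sampling assumptions, which concern points measurable with respect to the
past, to be applied to the iterates. -/
theorem isMeasurableState_run {Γ : AggGame N n m d r} (hset : Γ.SetAssumption)
    (hq : ∀ i t, Measurable (fun z : Γ.X i × Euc n × Euc (r i) => Γ.q i t z.1 z.2.1 z.2.2))
    (W : ℕ → Matrix (Fin N) (Fin N) ℝ) (α β γ : ℕ → ℝ) {x0 : ∀ i, Euc (d i)}
    (hx0 : ∀ i, x0 i ∈ Γ.X i) (t : ℕ) :
    IsMeasurableState (history ξ t) fun ω => Γ.run W α β γ x0 (fun t i => ξ i t ω) t := by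
  induction t with
  | zero =>
    exact ⟨fun _ => measurable_const, fun _ => measurable_const, fun _ => measurable_const,
      fun _ => measurable_const⟩
  | succ t ih =>
    exact (ih.mono (history_mono (Nat.le_succ t))).step hset (fun i => hq i t)
      (fun ω => (Γ.isTrajectory_run W α β γ x0 fun t i => ξ i t ω).x_mem hset hx0 t)
      (fun i => measurable_history (Nat.lt_succ_self t)) (W t) (α t) (β t) (γ t)

end History

/-- The expected gradients obey the bound of the sampled ones. -/
theorem norm_p_le {Γ : AggGame N n m d r} {Ω : Type*} [MeasurableSpace Ω] {P : Measure Ω}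
    [IsProbabilityMeasure P] {ξ : ∀ i : Fin N, ℕ → Ω → Euc (r i)} (hsamp : Γ.SampleAssumption P ξ)
    {S : ℝ} (hS : ∀ i t (x : Ω → Euc (d i)) (y : Ω → Euc n),
      Measurable[history ξ t] x → (∀ ω, x ω ∈ Γ.X i) → Measurable[history ξ t] y →
        ∀ᵐ ω ∂P, ‖Γ.q i t (x ω) (y ω) (ξ i t ω)‖ ≤ S)
    {i : Fin N} {x : Euc (d i)} (hx : x ∈ Γ.X i) (y : Euc n) : ‖Γ.p i x y‖ ≤ S := by
  have h1 := hsamp.unbiased i 0 (fun _ => x) (fun _ => y) measurable_const (fun _ => hx)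
    measurable_const
  have h2 := hS i 0 (fun _ => x) (fun _ => y) measurable_const (fun _ => hx) measurable_const
  have h3 := integral_congr_ae h1
  rw [integral_condExp (history_le hsamp.meas 0), integral_const, probReal_univ, one_smul] at h3
  rw [← h3]
  simpa using norm_integral_le_of_norm_le_const h2

/-- The sampling noise, tested against the error of the decisions, satisfies an Azuma bound. -/
theorem exists_noise_bound {Γ : AggGame N n m d r} {Ω : Type*} [MeasurableSpace Ω] {P : Measure Ω}
    [IsProbabilityMeasure P] {ξ : ∀ i : Fin N, ℕ → Ω → Euc (r i)} (hset : Γ.SetAssumption)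
    (hsamp : Γ.SampleAssumption P ξ) {xstar : ∀ i, Euc (d i)} (hmem : ∀ i, xstar i ∈ Γ.X i) :
    ∃ c > 0, ∀ (x : ℕ → ∀ i, Ω → Euc (d i)) (y : ℕ → ∀ _ : Fin N, Ω → Euc n),
      (∀ t i, Measurable[history ξ t] (x t i)) → (∀ t i ω, x t i ω ∈ Γ.X i) →
      (∀ t i, Measurable[history ξ t] (y t i)) → ∀ (T : ℕ) (l δ : ℝ), 0 < l → 0 < δ →
      1 - δ ≤ P.real {ω | ∑ t ∈ Finset.range T, ∑ i,
        inner ℝ (Γ.q i t (x t i ω) (y t i ω) (ξ i t ω) - Γ.p i (x t i ω) (y t i ω))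
          (xstar i - x t i ω) ≤ Real.log (1 / δ) / l + T * (l * c ^ 2 / 2)} := by
  obtain ⟨S, hS0, hS⟩ := hsamp.bounded
  obtain ⟨D, hD0, hD⟩ := hset.exists_diam
  -- Each player contributes at most 2SD; the added 1 keeps the constant positive even for N = 0.
  refine ⟨N * (2 * S * D) + 1, by positivity, fun x y hx hxm hy T l δ hl hδ => ?_⟩
  have hle := history_le hsamp.meas
  set Q : ℕ → ∀ i, Ω → Euc (d i) := fun t i ω => Γ.q i t (x t i ω) (y t i ω) (ξ i t ω) with hQ
  -- The conditional expectation replaces p, to which it is only almost everywhere equal, so that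
  -- the differences are measurable with respect to the history.
  set E : ℕ → ∀ i, Ω → Euc (d i) := fun t i => P[Q t i | history ξ t] with hE
  have hQm : ∀ t i, Measurable[history ξ (t + 1)] (Q t i) := fun t i =>
    Measurable.comp_of_mem₃ (h := Γ.q i t) (hsamp.q_meas i t)
      ((hx t i).mono (history_mono (Nat.le_succ t)) le_rfl) (hxm t i)
      ((hy t i).mono (history_mono (Nat.le_succ t)) le_rfl)
      (measurable_history (Nat.lt_succ_self t))
  have hQb : ∀ t i, ∀ᵐ ω ∂P, ‖Q t i ω‖ ≤ S := fun t i => hS i t _ _ (hx t i) (hxm t i) (hy t i)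
  have hEp : ∀ t i, E t i =ᵐ[P] fun ω => Γ.p i (x t i ω) (y t i ω) := fun t i =>
    hsamp.unbiased i t _ _ (hx t i) (hxm t i) (hy t i)
  have hQint : ∀ t i, Integrable (Q t i) P := fun t i =>
    Integrable.of_bound ((hQm t i).mono (hle _) le_rfl).aestronglyMeasurable S (hQb t i)
  have hEb : ∀ t i, ∀ᵐ ω ∂P, ‖E t i ω‖ ≤ S := fun t i => by
    filter_upwards [hEp t i] with ω hω
    rw [hω]
    exact norm_p_le hsamp hS (hxm t i ω) _
  have hterm : ∀ t i, ∀ᵐ ω ∂P, |inner ℝ (Q t i ω - E t i ω) (xstar i - x t i ω)| ≤ 2 * S * D := by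
    intro t i
    filter_upwards [hQb t i, hEb t i] with ω h1 h2
    refine (abs_real_inner_le_norm _ _).trans ?_
    refine mul_le_mul ((norm_sub_le _ _).trans (by linarith)) (hD i _ (hmem i) _ (hxm t i ω))
      (norm_nonneg _) (by positivity)
  have hQEm : ∀ t i, StronglyMeasurable[history ξ (t + 1)] (fun ω => Q t i ω - E t i ω) :=
    fun t i => (hQm t i).stronglyMeasurable.sub
      (stronglyMeasurable_condExp.mono (history_mono (Nat.le_succ t)))
  have hxs : ∀ t i, StronglyMeasurable[history ξ t] (fun ω => xstar i - x t i ω) := fun t i =>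
    stronglyMeasurable_const.sub (hx t i).stronglyMeasurable
  have htermm : ∀ t i, StronglyMeasurable[history ξ (t + 1)]
      (fun ω => inner ℝ (Q t i ω - E t i ω) (xstar i - x t i ω)) := fun t i =>
    (hQEm t i).inner ((hxs t i).mono (history_mono (Nat.le_succ t)))
  have htermint : ∀ t i, Integrable
      (fun ω => inner ℝ (Q t i ω - E t i ω) (xstar i - x t i ω)) P := fun t i =>
    Integrable.of_bound ((htermm t i).mono (hle _)).aestronglyMeasurable (2 * S * D) (hterm t i)
  have hazuma := measureReal_sum_martingaleDiff_ge_le (P := P) (ℱ := history ξ) history_mono hle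
    (D := fun t ω => ∑ i, inner ℝ (Q t i ω - E t i ω) (xstar i - x t i ω))
    (fun t => Finset.stronglyMeasurable_fun_sum _ fun i _ => htermm t i)
    (c := N * (2 * S * D) + 1) (by positivity) (fun t => ?_) (fun t => ?_) hl hδ T
  · set bad : Set Ω := {ω | Real.log (1 / δ) / l + T * (l * (N * (2 * S * D) + 1) ^ 2 / 2)
      ≤ ∑ t ∈ Finset.range T, ∑ i, inner ℝ (Q t i ω - E t i ω) (xstar i - x t i ω)} with hbad
    have hbm : MeasurableSet bad := measurableSet_le measurable_const
      (Finset.measurable_sum _ fun t _ => Finset.measurable_sum _ fun i _ =>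
        ((htermm t i).mono (hle _)).measurable)
    have h1 : 1 - δ ≤ P.real badᶜ := by
      rw [probReal_compl_eq_one_sub hbm]
      linarith
    refine h1.trans ?_
    have hall : ∀ᵐ ω ∂P, ∀ t i, E t i ω = Γ.p i (x t i ω) (y t i ω) :=
      ae_all_iff.2 fun t => ae_all_iff.2 fun i => hEp t i
    refine ENNReal.toReal_mono (measure_ne_top _ _) (measure_mono_ae ?_)
    filter_upwards [hall] with ω hω hc
    have hc' : ∑ t ∈ Finset.range T, ∑ i, inner ℝ (Q t i ω - E t i ω) (xstar i - x t i ω)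
        < Real.log (1 / δ) / l + T * (l * (N * (2 * S * D) + 1) ^ 2 / 2) := not_le.1 hc
    simp only [hω] at hc'
    exact hc'.le
  · filter_upwards [ae_all_iff.2 (hterm t)] with ω hω
    refine (Finset.abs_sum_le_sum_abs _ _).trans ((Finset.sum_le_sum fun i _ => hω i).trans ?_)
    simp
  · have hone : ∀ i, P[fun ω => inner ℝ (Q t i ω - E t i ω) (xstar i - x t i ω) | history ξ t]
        =ᵐ[P] 0 := by
      intro i
      have h1 := condExp_bilin_of_stronglyMeasurable_right (μ := P) (innerSL ℝ)
        (f := Q t i - E t i) (hxs t i) (htermint t i) ((hQint t i).sub integrable_condExp)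
      have h2 : P[Q t i - E t i | history ξ t] =ᵐ[P] 0 := by
        have h3 := condExp_sub (m := history ξ t) (hQint t i) (integrable_condExp (m := history ξ t) (f := Q t i) (μ := P))
        have h4 : P[E t i | history ξ t] = E t i :=
          condExp_of_stronglyMeasurable (hle t) stronglyMeasurable_condExp integrable_condExp
        filter_upwards [h3] with ω hω
        have h5 : (P[E t i | history ξ t]) ω = E t i ω := by rw [h4]
        rw [hω]
        simp only [Pi.sub_apply, Pi.zero_apply]
        rw [sub_eq_zero]
        exact h5.symm
      filter_upwards [h1, h2] with ω hω1 hω2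
      refine hω1.trans ?_
      rw [hω2]
      simp
    have hsum := condExp_finsetSum (μ := P) (s := Finset.univ)
      (f := fun i ω => inner ℝ (Q t i ω - E t i ω) (xstar i - x t i ω))
      (fun i _ => htermint t i) (history ξ t)
    have hfun : (∑ i, fun ω => inner ℝ (Q t i ω - E t i ω) (xstar i - x t i ω))
        = fun ω => ∑ i, inner ℝ (Q t i ω - E t i ω) (xstar i - x t i ω) := by
      ext ω; simp
    rw [hfun] at hsum
    filter_upwards [hsum, ae_all_iff.2 hone] with ω h1 h2
    rw [h1, Finset.sum_apply]
    exact Finset.sum_eq_zero fun i _ => h2 i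

end AggGame

/-! ### Averaging and conclusion -/

/-- Cauchy-Schwarz for the average; the nonnegative term at time 0 is added to match the range of
the regret sum. -/
theorem norm_average_sub_sq_le {E : Type*} [NormedAddCommGroup E] [NormedSpace ℝ E] (x : ℕ → E)
    (c : E) {T : ℕ} (hT : 1 ≤ T) :
    T * ‖(1 / (T : ℝ)) • ∑ t ∈ Finset.Icc 1 T, x t - c‖ ^ 2
      ≤ ∑ t ∈ Finset.range (T + 1), ‖x t - c‖ ^ 2 := by
  have hT0 : (0 : ℝ) < T := by exact_mod_cast hT
  have e : (1 / (T : ℝ)) • ∑ t ∈ Finset.Icc 1 T, x t - c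
      = (1 / (T : ℝ)) • ∑ t ∈ Finset.Icc 1 T, (x t - c) := by
    rw [Finset.sum_sub_distrib, smul_sub, Finset.sum_const, Nat.card_Icc, Nat.add_sub_cancel,
      ← Nat.cast_smul_eq_nsmul ℝ, smul_smul, one_div_mul_cancel hT0.ne', one_smul]
  have h1 : ‖∑ t ∈ Finset.Icc 1 T, (x t - c)‖ ^ 2 ≤ T * ∑ t ∈ Finset.Icc 1 T, ‖x t - c‖ ^ 2 := by
    refine (pow_le_pow_left₀ (norm_nonneg _) (norm_sum_le _ _) 2).trans ?_
    simpa using sq_sum_le_card_mul_sum_sq (s := Finset.Icc 1 T) (f := fun t => ‖x t - c‖)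
  have h2 : ∑ t ∈ Finset.Icc 1 T, ‖x t - c‖ ^ 2 ≤ ∑ t ∈ Finset.range (T + 1), ‖x t - c‖ ^ 2 :=
    Finset.sum_le_sum_of_subset_of_nonneg
      (fun t ht => Finset.mem_range.2 (Nat.lt_succ_of_le (Finset.mem_Icc.1 ht).2))
      fun _ _ _ => by positivity
  rw [e, norm_smul, mul_pow, norm_div, norm_one, RCLike.norm_natCast]
  calc (T : ℝ) * ((1 / T) ^ 2 * ‖∑ t ∈ Finset.Icc 1 T, (x t - c)‖ ^ 2)
      ≤ T * ((1 / T) ^ 2 * (T * ∑ t ∈ Finset.Icc 1 T, ‖x t - c‖ ^ 2)) := by gcongr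
    _ = ∑ t ∈ Finset.Icc 1 T, ‖x t - c‖ ^ 2 := by field_simp
    _ ≤ _ := h2

theorem theorem3 {N n m : ℕ} (hN : 0 < N) {d r : Fin N → ℕ} (Γ : AggGame N n m d r)
    (W : ℕ → Matrix (Fin N) (Fin N) ℝ)
    {Ω : Type*} [MeasurableSpace Ω] (P : Measure Ω) [IsProbabilityMeasure P]
    (ξ : ∀ i : Fin N, ℕ → Ω → Euc (r i))
    (hΓ : Γ.TimeInvariant) (hW : GraphAssumption W) (hset : Γ.SetAssumption)
    (hlip : Γ.GradLipschitz) (hsamp : Γ.SampleAssumption P ξ)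
    (κ : ℝ) (hκ : 0 < κ) (hmono : Γ.StronglyMonotone κ)
    (a1 a2 a3 : ℝ) (ha1 : 0 < a1) (ha1' : a1 < 1) (ha3 : 0 < a3) (ha3' : a3 < 1)
    (ha2 : 0 < 2 * a2) (ha12 : 2 * a2 < a1) (ha23 : 2 * a2 + a3 < 1)
    (x0 : ∀ i, Euc (d i)) (hx0 : ∀ i, x0 i ∈ Γ.X i)
    (xstar : ∀ i, Euc (d i)) (hxstar : Γ.IsVGNE xstar) :
    ∃ C > 0, ∀ T : ℕ, 1 ≤ T → ∀ δ : ℝ, 0 < δ → δ < 1 →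
      1 - δ ≤ P.real {ω |
        ‖Γ.avgDecision W (polyStep a1) (polyStep a2) (polyStep a3) x0 (fun t i => ξ i t ω) T
            - WithLp.toLp 2 xstar‖ ^ 2
          ≤ C * ((T : ℝ) ^ (-rateExp a1 a2 a3) + (T : ℝ) ^ (-(1 - a1)) * Real.log (1 / δ))} := by

  obtain ⟨S, hS0, hS⟩ := hsamp.bounded
  have hmem := hxstar.1.1
  obtain ⟨C₁, hC₁, hregret⟩ := Γ.exists_regret_bound hN hset hW (stepSizes_polyStep ha2 ha12 ha3)
    hlip hmono hx0 hxstar hS0.le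
  obtain ⟨C₂, hC₂, hrate⟩ := exists_polyStep_rate ha1' ha3 ha3' ha2 ha12 ha23
  obtain ⟨c, hc, hnoise⟩ := AggGame.exists_noise_bound hset hsamp hmem
  refine ⟨(C₁ * C₂ + c ^ 2 + 1) / κ, by positivity, fun T hT δ hδ hδ1 => ?_⟩
  set st : ℕ → Ω → AggGame.AlgState N n m d := fun t ω =>
    Γ.run W (polyStep a1) (polyStep a2) (polyStep a3) x0 (fun t i => ξ i t ω) t with hst
  have htraj := fun ω => Γ.isTrajectory_run W (polyStep a1) (polyStep a2) (polyStep a3) x0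
    fun t i => ξ i t ω
  have hmeas : ∀ t, AggGame.IsMeasurableState (AggGame.history ξ t) (st t) := fun t =>
    AggGame.isMeasurableState_run hset hsamp.q_meas W _ _ _ hx0 t
  set x : ℕ → ∀ i, Ω → Euc (d i) := fun t i ω => (st t ω).x i with hx
  set y : ℕ → ∀ _ : Fin N, Ω → Euc n := fun t i ω =>
    pushSumEstimate W (fun t => (st t ω).sigma) t i with hy
  have hxm : ∀ t i, Measurable[AggGame.history ξ t] (x t i) := fun t i => (hmeas t).x i
  have hxX : ∀ t i ω, x t i ω ∈ Γ.X i := fun t i ω => (htraj ω).x_mem hset hx0 t i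
  have hym : ∀ t i, Measurable[AggGame.history ξ t] (y t i) := fun t i =>
    Measurable.const_smul (Finset.measurable_sum Finset.univ fun j _ =>
      Measurable.const_smul ((hmeas t).sigma j) (W t i j)) (pushWeight W (t + 1) i)⁻¹
  have hT0 : (0 : ℝ) < T := by exact_mod_cast hT
  have hT1 : (1 : ℝ) ≤ T := by exact_mod_cast hT
  -- This Chernoff parameter turns ln(1/δ)/l into T · T^(-(1-a1)) ln(1/δ), and the variance term
  -- into a multiple of T · T^(-a1), which is within the rate.
  have hl : 0 < (T : ℝ) ^ (-a1) := Real.rpow_pos_of_pos hT0 _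
  refine (hnoise x y hxm hxX hym (T + 1) ((T : ℝ) ^ (-a1)) δ hl hδ).trans ?_
  have hQ : ∀ᵐ ω ∂P, ∀ t i, ‖Γ.q i t (x t i ω) (y t i ω) (ξ i t ω)‖ ≤ S :=
    ae_all_iff.2 fun t => ae_all_iff.2 fun i => hS i t _ _ (hxm t i) (hxX t i) (hym t i)
  -- Monotonicity holds for outer measures, so the target event need not be measurable. The
  -- inclusion holds off the null set where some sampled gradient exceeds S.
  refine ENNReal.toReal_mono (measure_ne_top _ _) (measure_mono_ae ?_)
  filter_upwards [hQ] with ω hω hgood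
  have h1 := hregret _ _ _ _ (htraj ω) hω T
  have h2 := mul_le_mul_of_nonneg_left (hrate T hT) hC₁.le
  have h3 := mul_le_mul_of_nonneg_left
    (norm_average_sub_sq_le (fun t => WithLp.toLp 2 (st t ω).x) (WithLp.toLp 2 xstar) hT) hκ.le
  have hgood' : ∑ t ∈ Finset.range (T + 1), ∑ i,
      inner ℝ (Γ.q i t (x t i ω) (y t i ω) (ξ i t ω) - Γ.p i (x t i ω) (y t i ω))
        (xstar i - x t i ω)
      ≤ Real.log (1 / δ) / (T : ℝ) ^ (-a1) + (T + 1 : ℕ) * ((T : ℝ) ^ (-a1) * c ^ 2 / 2) := hgood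
  have hlog : 0 ≤ Real.log (1 / δ) := Real.log_nonneg ((one_le_div hδ).2 hδ1.le)
  have hra : rateExp a1 a2 a3 ≤ a1 := by
    have : rateExp a1 a2 a3 ≤ a1 - 2 * a2 := (min_le_right _ _).trans
      ((min_le_right _ _).trans ((min_le_right _ _).trans (min_le_right _ _)))
    linarith
  set ρ := rateExp a1 a2 a3 with hρ
  have e1 : Real.log (1 / δ) / (T : ℝ) ^ (-a1) = T * ((T : ℝ) ^ (-(1 - a1)) * Real.log (1 / δ)) := by
    rw [Real.rpow_neg hT0.le, div_inv_eq_mul, ← mul_assoc]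
    nth_rewrite 2 [← Real.rpow_one (T : ℝ)]
    rw [← Real.rpow_add hT0]
    ring_nf
  have e2 : (T : ℝ) ^ (1 - ρ) = T * (T : ℝ) ^ (-ρ) := by
    rw [sub_eq_add_neg, Real.rpow_add hT0, Real.rpow_one]
  have h4 : (T : ℝ) ^ (-a1) ≤ (T : ℝ) ^ (-ρ) :=
    Real.rpow_le_rpow_of_exponent_le hT1 (by linarith)
  -- T + 1 ≤ 2T, and the 2 cancels the 1/2 of the variance term.
  have h5 : ((T + 1 : ℕ) : ℝ) * ((T : ℝ) ^ (-a1) * c ^ 2 / 2) ≤ T * (c ^ 2 * (T : ℝ) ^ (-ρ)) := by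
    calc ((T + 1 : ℕ) : ℝ) * ((T : ℝ) ^ (-a1) * c ^ 2 / 2)
        ≤ (2 * T) * ((T : ℝ) ^ (-ρ) * c ^ 2 / 2) := by
          push_cast
          gcongr
          linarith
      _ = _ := by ring
  rw [e1] at hgood'
  rw [e2] at h2
  have hA : 0 ≤ (T : ℝ) ^ (-ρ) := Real.rpow_nonneg hT0.le _
  have hB : 0 ≤ (T : ℝ) ^ (-(1 - a1)) * Real.log (1 / δ) :=
    mul_nonneg (Real.rpow_nonneg hT0.le _) hlog
  set A := (T : ℝ) ^ (-ρ)
  set B := (T : ℝ) ^ (-(1 - a1)) * Real.log (1 / δ)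
  have h6 : T * (κ * ‖Γ.avgDecision W (polyStep a1) (polyStep a2) (polyStep a3) x0
      (fun t i => ξ i t ω) T - WithLp.toLp 2 xstar‖ ^ 2) ≤ T * (B + c ^ 2 * A + C₁ * (C₂ * A)) := by
    rw [AggGame.avgDecision]
    linarith
  have h7 := le_of_mul_le_mul_left h6 hT0
  change _ ≤ _
  rw [div_mul_eq_mul_div, le_div_iff₀ hκ]
  nlinarith [mul_nonneg (mul_nonneg hC₁.le hC₂.le) hB, mul_nonneg (sq_nonneg c) hB]
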